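/- **Setting.** Let $c_i$ $(i\in\mathcal E)$ and $c_j$ $(j\in\mathcal I)$ be finitely many polynomials in $\mathbb R[x]=\mathbb R[x_1,\dots,x_n]$ and $$K=\{x\in\mathbb R^n : c_i(x)=0\ (i\in\mathcal E),\ c_j(x)\ge 0\ (j\in\mathcal I)\}.$$ Write $\mathbb N^n_m=\{\alpha\in\mathbb N^n:|\alpha|\le m\}$, $\tilde x=(x_0,x)$, and let $\tilde p(\tilde x)=x_0^{\deg p}\,p(x/x_0)$ be the homogenization of a polynomial $p$. Put $$\widetilde K^h=\{\tilde x\in\mathbb R^{n+1}:\tilde c_i(\tilde x)=0\ (i\in\mathcal E),\ \tilde c_j(\tilde x)\ge 0\ (j\in\mathcal I),\ x_0\ge 0\},\qquad \widetilde K^c=\widetilde K^h\cap\{x_0>0\}.$$ $K$ (with its describing polynomials) is *closed at $\infty$* if $\mathrm{cl}(\widetilde K^c)=\widetilde K^h$. Let $\mathcal A\subset\mathbb N^n$ be a finite set, $d=\max\{|\alpha|:\alpha\in\mathcal A\}$ ($d=0$ if $\mathcal A=\emptyset$), and $\mathbb R[x]_{\mathcal A}=\mathrm{Span}\{x^\alpha:\alpha\in\mathcal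 A\}$. Let $$\mathscr P_{\mathcal A}(K)=\{p\in\mathbb R[x]_{\mathcal A}: p\ge 0\text{ on }K\},\qquad \mathscr P_d(K)=\mathscr P_{\mathbb N^n_d}(K),$$ with interiors taken in $\mathbb R[x]_{\mathcal A}$ and in $\mathbb R[x]_d=\mathbb R[x]_{\mathbb N^n_d}$ respectively, and let $\mathscr R_{\mathcal A}(K)$ be the set of $y=(y_\alpha)_{\alpha\in\mathcal A}\in\mathbb R^{\mathcal A}$ for which there is a positive Borel measure $\mu$ on $\mathbb R^n$ with $\mathrm{supp}\,\mu\subseteq K$ and $y_\alpha=\int x^\alpha\,d\mu$ for all $\alpha\in\mathcal A$. For $w\in\mathbb R^{\mathbb N^{n+1}_{2k}}$ and $q\in\mathbb R[\tilde x]$, let $L^{(k)}_q[w]$ be the symmetric matrix, indexed by the exponents $\alpha\in\mathbb N^{n+1}$ with $\deg q+2|\alpha|\le 2k$, whose $(\alpha,\beta)$ entry is $\sum_\gamma q_\gamma w_{\gamma+\alpha+\beta}$, and let $M_k[w]=L^{(k)}_1[w]$. For $k\in\mathbb N$ with $2k\ge d$, let $\mathscr R^{(k)}(K)$ be the set of $y\in\mathbb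 R^{\mathcal A}$ for which there is $w\in\mathbb R^{\mathbb N^{n+1}_{2k}}$ with $w_{(d-|\alpha|,\alpha)}=y_\alpha$ for all $\alpha\in\mathcal A$ and $$L^{(k)}_{\tilde c_i}[w]=0\ (i\in\mathcal E),\quad L^{(k)}_{\|\tilde x\|^2-1}[w]=0,\quad L^{(k)}_{\tilde c_j}[w]\succeq 0\ (j\in\mathcal I),\quad L^{(k)}_{x_0}[w]\succeq 0,\quad M_k[w]\succeq 0.$$ Let $\tilde c_{eq}$ be the tuple of the $\tilde c_i$ $(i\in\mathcal E)$ together with $\|\tilde x\|^2-1$, and $\tilde c_{in}$ the tuple of the $\tilde c_j$ $(j\in\mathcal I)$ together with $x_0$. Let $\Sigma[\tilde x]_m$ be the set of sums of squares of polynomials that have degree at most $m$ (only $0$ if $m<0$), and likewise $\mathbb R[\tilde x]_m=\{0\}$ if $m<0$. Put $$\mathrm{Ideal}[h]_{2k}=\sum_i h_i\,\mathbb R[\tilde x]_{2k-\deg h_i},\qquad \mathrm{QM}[g]_{2k}=\Sigma[\tilde x]_{2k}+\sum_j g_j\,\Sigma[\tilde x]_{2k-2\lceil\deg(g_j)/2\rceil},$$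 $$\mathscr P^{(k)}(K)=\{p\in\mathbb R[x]_{\mathcal A}:\ \tilde p\in \mathrm{Ideal}[\tilde c_{eq}]_{2k}+\mathrm{QM}[\tilde c_{in}]_{2k}\}.$$ **Theorem.** Suppose $K$ is closed at $\infty$ and $\mathbb R[x]_{\mathcal A}\cap \mathrm{int}(\mathscr P_d(K))\ne\emptyset$. Then: 1. $\mathscr R^{(k+1)}(K)\subseteq\mathscr R^{(k)}(K)$ for every $k$ with $2k\ge d$, and $$\bigcap_{k\ge 1,\ 2k\ge d}\mathscr R^{(k)}(K)=\mathrm{cl}(\mathscr R_{\mathcal A}(K)).$$ 2. $$\mathrm{int}(\mathscr P_{\mathcal A}(K))\subseteq\bigcup_{k=1}^{\infty}\mathscr P^{(k)}(K)\subseteq\mathscr P_{\mathcal A}(K).$$ -/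

import Mathlib

open MeasureTheory
open scoped Pointwise

noncomputable section

namespace GTMP

/-- The exponents of length `n` and order at most `d`, i.e. `ℕ^n_d = {α ∈ ℕ^n : |α| ≤ d}`. -/
def expLE (n d : ℕ) : Finset (Fin n →₀ ℕ) := (Finsupp.finite_of_degree_le d).toFinset

@[simp] theorem mem_expLE {n d : ℕ} {α : Fin n →₀ ℕ} : α ∈ expLE n d ↔ α.degree ≤ d := by
  simp [expLE]

/-- The degree of a finite power set: the maximum of `|α|` over `α ∈ A` (and `0` if `A = ∅`). -/
def expDeg {n : ℕ} (A : Finset (Fin n →₀ ℕ)) : ℕ := A.sup Finsupp.degree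

/-- The space `ℝ[x]_A` of polynomials spanned by the monomials `x^α`, `α ∈ A`. -/
def polyA {n : ℕ} (A : Finset (Fin n →₀ ℕ)) : Submodule ℝ (MvPolynomial (Fin n) ℝ) :=
  MvPolynomial.restrictSupport ℝ (A : Set (Fin n →₀ ℕ))

/-- The coefficient vector in `ℝ^A` of a polynomial (meant for polynomials in `ℝ[x]_A`). -/
def coeffVec {n : ℕ} (A : Finset (Fin n →₀ ℕ)) (p : MvPolynomial (Fin n) ℝ) : A → ℝ :=
  fun α => p.coeff α.1

/-- The interior, relative to the space `ℝ[x]_A ≅ ℝ^A` with its Euclidean topology, of a set `S`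
of polynomials contained in `ℝ[x]_A`. -/
def interiorA {n : ℕ} (A : Finset (Fin n →₀ ℕ)) (S : Set (MvPolynomial (Fin n) ℝ)) :
    Set (MvPolynomial (Fin n) ℝ) :=
  {p | p ∈ polyA A ∧ coeffVec A p ∈ interior (coeffVec A '' S)}

/-! ### Semialgebraic sets, moment cones and cones of nonnegative polynomials -/

/-- The set `{x ∈ ℝ^n : c_i(x) = 0 (i ∈ E), c_j(x) ≥ 0 (j ∈ I)}`. -/
def semialgSet {n : ℕ} {E I : Type*} (cE : E → MvPolynomial (Fin n) ℝ)
    (cI : I → MvPolynomial (Fin n) ℝ) : Set (Fin n → ℝ) :=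
  {x | (∀ i, MvPolynomial.eval x (cE i) = 0) ∧ ∀ j, 0 ≤ MvPolynomial.eval x (cI j)}

/-- The cone `P_A(K)` of the polynomials in `ℝ[x]_A` that are nonnegative on `K`. -/
def nonnegCone {n : ℕ} (A : Finset (Fin n →₀ ℕ)) (K : Set (Fin n → ℝ)) :
    Set (MvPolynomial (Fin n) ℝ) :=
  {p | p ∈ polyA A ∧ ∀ x ∈ K, 0 ≤ MvPolynomial.eval x p}

/-- The moment cone `R_A(K)`: the vectors `y ∈ ℝ^A` for which there is a positive Borel measure `μ`
on `ℝ^n` with support in `K` and `y_α = ∫ x^α dμ` (with existing integrals) for all `α ∈ A`. -/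
def momentCone {n : ℕ} (A : Finset (Fin n →₀ ℕ)) (K : Set (Fin n → ℝ)) : Set (A → ℝ) :=
  {y | ∃ μ : Measure (Fin n → ℝ), μ.support ⊆ K ∧
    ∀ α : A, Integrable (fun x : Fin n → ℝ => ∏ i, x i ^ α.1 i) μ ∧
      y α = ∫ x : Fin n → ℝ, ∏ i, x i ^ α.1 i ∂μ}

/-! ### Homogenization. The homogenizing variable `x₀` has index `0` in `Fin (n + 1)`. -/

/-- The homogenized exponent `(d - |α|, α)`. -/
def homExp {n : ℕ} (d : ℕ) (α : Fin n →₀ ℕ) : Fin (n + 1) →₀ ℕ := Finsupp.cons (d - α.degree) α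

/-- The homogenization `x₀^deg(p) p(x/x₀)` of `p`. -/
def homogenization {n : ℕ} (p : MvPolynomial (Fin n) ℝ) : MvPolynomial (Fin (n + 1)) ℝ :=
  ∑ α ∈ p.support, MvPolynomial.monomial (homExp p.totalDegree α) (p.coeff α)

/-- The homogenized set: all `x̃ = (x₀, x)` with `c̃_i(x̃) = 0`, `c̃_j(x̃) ≥ 0` and `x₀ ≥ 0`. -/
def homSet {n : ℕ} {E I : Type*} (cE : E → MvPolynomial (Fin n) ℝ)
    (cI : I → MvPolynomial (Fin n) ℝ) : Set (Fin (n + 1) → ℝ) :=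
  semialgSet (fun i => homogenization (cE i)) (fun j => homogenization (cI j)) ∩ {z | 0 ≤ z 0}

/-- The set described by the polynomials `c` is closed at `∞`: the part of the homogenized set
with `x₀ > 0` is dense in it, i.e. its closure is the whole homogenized set. -/
def ClosedAtInfinity {n : ℕ} {E I : Type*} (cE : E → MvPolynomial (Fin n) ℝ)
    (cI : I → MvPolynomial (Fin n) ℝ) : Prop :=
  closure (homSet cE cI ∩ {z | 0 < z 0}) = homSet cE cI

/-- The tuple of equality constraints `c̃_i` (`i ∈ E`) together with `‖x̃‖² - 1`. -/
def homEq {n : ℕ} {E : Type*} (cE : E → MvPolynomial (Fin n) ℝ) :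
    Option E → MvPolynomial (Fin (n + 1)) ℝ
  | none => ∑ i, MvPolynomial.X i ^ 2 - 1
  | some i => homogenization (cE i)

/-- The tuple of inequality constraints `c̃_j` (`j ∈ I`) together with `x₀`. -/
def homIneq {n : ℕ} {I : Type*} (cI : I → MvPolynomial (Fin n) ℝ) :
    Option I → MvPolynomial (Fin (n + 1)) ℝ
  | none => MvPolynomial.X 0
  | some j => homogenization (cI j)

/-! ### Moment relaxations -/

/-- The Riesz functional of a truncated multi-sequence `w` of degree `m`. -/
def riesz {N m : ℕ} (w : expLE N m → ℝ) (q : MvPolynomial (Fin N) ℝ) : ℝ :=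
  ∑ β : expLE N m, q.coeff β.1 * w β

/-- Row and column labels of the `k`-th localizing matrix of `q`: the exponents of the monomials
`x^α` with `deg (q · (x^α)²) ≤ 2k`. There are none if `deg q > 2k`. -/
def locIndex {N : ℕ} (k : ℕ) (q : MvPolynomial (Fin N) ℝ) : Finset (Fin N →₀ ℕ) :=
  {α ∈ expLE N k | q.totalDegree + 2 * α.degree ≤ 2 * k}

/-- The `k`-th localizing matrix `L_q^(k)[w]`; its entry at `(α, β)` is `ℒ_w(q x^(α+β))`, so that
`ℒ_w(q p²)` is the associated quadratic form at the coefficient vector of `p`. -/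
def locMatrix {N : ℕ} (k : ℕ) (q : MvPolynomial (Fin N) ℝ) (w : expLE N (2 * k) → ℝ) :
    Matrix (locIndex k q) (locIndex k q) ℝ :=
  Matrix.of fun α β => riesz w (q * MvPolynomial.monomial (α.1 + β.1) 1)

/-- The `k`-th moment relaxation `R^(k)(K)` (for `2k ≥ deg A`): those `y ∈ ℝ^A` whose
homogenization is the restriction of some `w` of degree `2k` satisfying the localizing and moment
matrix conditions. -/
def momentRelax {n : ℕ} {E I : Type*} (A : Finset (Fin n →₀ ℕ))
    (cE : E → MvPolynomial (Fin n) ℝ) (cI : I → MvPolynomial (Fin n) ℝ) (k : ℕ) : Set (A → ℝ) :=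
  {y | ∃ w : expLE (n + 1) (2 * k) → ℝ,
    (∀ α : A, ∃ h : homExp (expDeg A) α.1 ∈ expLE (n + 1) (2 * k), w ⟨_, h⟩ = y α) ∧
    (∀ i : Option E, locMatrix k (homEq cE i) w = 0) ∧
    (∀ j : Option I, (locMatrix k (homIneq cI j) w).PosSemidef) ∧
    (locMatrix k 1 w).PosSemidef}

/-! ### Sum-of-squares approximations -/

/-- The truncated ideal `∑ h_i · ℝ[x]_{m - deg h_i}`. -/
def truncIdeal {N : ℕ} {ι : Type*} [Fintype ι] (h : ι → MvPolynomial (Fin N) ℝ) (m : ℕ) :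
    Set (MvPolynomial (Fin N) ℝ) :=
  {p | ∃ r : ι → MvPolynomial (Fin N) ℝ,
    (∀ i, r i ≠ 0 → (r i).totalDegree + (h i).totalDegree ≤ m) ∧ p = ∑ i, h i * r i}

/-- The truncated quadratic module `Σ[x]_m + ∑ g_j · Σ[x]_{m - 2⌈deg(g_j)/2⌉}` (`m` even). -/
def truncQM {N : ℕ} {ι : Type*} [Fintype ι] (g : ι → MvPolynomial (Fin N) ℝ) (m : ℕ) :
    Set (MvPolynomial (Fin N) ℝ) :=
  {p | ∃ (s₀ : MvPolynomial (Fin N) ℝ) (s : ι → MvPolynomial (Fin N) ℝ),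
    (IsSumSq s₀ ∧ s₀.totalDegree ≤ m) ∧
    (∀ j, IsSumSq (s j) ∧
      (s j ≠ 0 → (s j).totalDegree + 2 * (((g j).totalDegree + 1) / 2) ≤ m)) ∧
    p = s₀ + ∑ j, g j * s j}

/-- The `k`-th SOS approximation `P^(k)(K)`. -/
def sosApprox {n : ℕ} {E I : Type*} [Fintype E] [Fintype I] (A : Finset (Fin n →₀ ℕ))
    (cE : E → MvPolynomial (Fin n) ℝ) (cI : I → MvPolynomial (Fin n) ℝ) (k : ℕ) :
    Set (MvPolynomial (Fin n) ℝ) :=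
  {p | p ∈ polyA A ∧
    homogenization p ∈ truncIdeal (homEq cE) (2 * k) + truncQM (homIneq cI) (2 * k)}

end GTMP

end

open GTMP

/-!
Both hierarchies are governed by one Positivstellensatz on the sphere. The set
`S = {c̃_eq = 0, c̃_in ≥ 0}` is compact because the equation `‖x̃‖² = 1` is among its constraints,
so Putinar's theorem (`mem_idealQM_of_pos`) applies: a polynomial that is positive on `S` lies in
`Ideal[c̃_eq] + QM[c̃_in]`. It is a case of the representation theorem `mem_of_forall_algHom_pos` for
a module `Q` over an archimedean preordering `T`, here `T = Σ + Ideal[‖x̃‖² - 1]`. If `f ∉ Q`, the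
Riesz extension theorem gives a state of `Q` that is nonpositive at `f`, and Krein–Milman an extreme
one; an extreme state `L` is multiplicative, because whenever `h, c - h ∈ T` it is a convex
combination of the states proportional to `L (h ·)` and `L ((c - h) ·)`. So it is the evaluation at
a point of `S` where `f ≤ 0`.

Closedness at infinity carries inequalities between polynomials from `K` to their homogenizations
on the whole homogenized set (`mul_eval_homPoly_le`). In particular the given polynomial
`q ∈ ℝ[x]_A ∩ int P_d(K)` has a homogenization of degree `d` that is positive on `S`, hence at
least some `ε > 0` there (`eval_homPoly_pos_of_mem_interiorA`). It is used three times.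

* If `p` is interior to `P_A(K)`, then `p ≥ δ q` on `K` for some `δ > 0`, so `p̃ > 0` on `S`, and
  Putinar's theorem gives `p ∈ P^(k)(K)` for large `k`.
* If `y` lies in all relaxations but not in the closure of the moment cone, Farkas' lemma gives
  `p ≥ 0` on `K` with negative value at `y`. So has `p + δ q` for small `δ > 0`, although its
  homogenization is positive on `S` and therefore nonnegative under every Riesz functional that is
  feasible for a large `k`.
* If `μ` is a measure on `K` with `A`-moments `y`, then `ε ∫ ‖(1, x)‖^d dμ ≤ ∫ q dμ`. Hence the
  image of `‖(1, x)‖^d dμ` under central projection to the sphere is a finite measure. Its moments are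
  feasible and bounded in terms of `y`, and compactness shows that each relaxation contains even the
  closure of the moment cone.
-/

open GTMP

noncomputable section

/-! ### Representation of archimedean modules over a preordering -/

section Representation

variable {R : Type*} [CommRing R] [Algebra ℝ R]

/-- The states of the cone `Q`: the normalized linear functionals on `R` that are nonnegative on
`Q`. They are encoded as plain functions, so that the set lives in the product space `R → ℝ`. -/
def stateSet (Q : AddSubmonoid R) : Set (R → ℝ) :=
  {L | (∀ a b, L (a + b) = L a + L b) ∧ (∀ (r : ℝ) a, L (r • a) = r * L a) ∧
    (∀ q ∈ Q, 0 ≤ L q) ∧ L 1 = 1}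

theorem isCompact_stateSet {Q : AddSubmonoid R}
    (hQ : ∀ a : R, ∃ N : ℝ, algebraMap ℝ R N - a ∈ Q) : IsCompact (stateSet Q) := by
  choose N hN using hQ
  have hclosed : IsClosed (stateSet Q) := by
    simp only [stateSet, Set.ofPred_and, Set.ofPred_forall]
    refine IsClosed.inter ?_ (IsClosed.inter ?_ (IsClosed.inter ?_ ?_))
    · exact isClosed_iInter fun a => isClosed_iInter fun b =>
        isClosed_eq (by fun_prop) (by fun_prop)
    · exact isClosed_iInter fun a => isClosed_iInter fun b =>
        isClosed_eq (by fun_prop) (by fun_prop)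
    · exact isClosed_iInter fun a => isClosed_iInter fun b =>
        isClosed_le (by fun_prop) (by fun_prop)
    · exact isClosed_eq (by fun_prop) (by fun_prop)
  refine (isCompact_univ_pi fun a => isCompact_Icc (a := -N (-a)) (b := N a)).of_isClosed_subset
    hclosed ?_
  rintro L ⟨hadd, hsmul, hpos, hone⟩ a -
  have hle : ∀ a, L a ≤ N a := by
    intro a
    have h := hpos _ (hN a)
    have h1 : L (algebraMap ℝ R (N a) - a) = N a - L a := by
      have : algebraMap ℝ R (N a) - a = N a • (1 : R) + (-1 : ℝ) • a := by
        rw [Algebra.algebraMap_eq_smul_one]; simp [sub_eq_add_neg]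
      rw [this, hadd, hsmul, hsmul, hone]; ring
    linarith
  have hneg := hle (-a)
  have : L (-a) = - L a := by
    rw [← neg_one_smul ℝ a, hsmul]; ring
  exact ⟨by linarith, hle a⟩

/-- For `h` in the preordering with `L h` and `L (N - h)` positive, `L` is a proper convex
combination of the states `L (h ·) / L h` and `L ((N - h) ·) / L (N - h)`; an extreme state
therefore agrees with the first of them. -/
theorem map_mul_of_mem_extremePoints_stateSet {T : Subsemiring R} {Q : AddSubmonoid R}
    (harch : ∀ a : R, ∃ N : ℝ, algebraMap ℝ R N - a ∈ T)
    (hone : (1 : R) ∈ Q) (hmul : ∀ t ∈ T, ∀ q ∈ Q, t * q ∈ Q)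
    (hT : ∀ r : ℝ, 0 ≤ r → algebraMap ℝ R r ∈ T)
    {L : R → ℝ} (hL : L ∈ (stateSet Q).extremePoints ℝ) (a p : R) : L (a * p) = L a * L p := by
  obtain ⟨⟨hadd, hsmul, hpos, hL1⟩, hext⟩ := hL
  have hTQ : ∀ t ∈ T, t ∈ Q := fun t ht => by simpa using hmul t ht 1 hone
  have hsub : ∀ (r : ℝ) a p, L ((algebraMap ℝ R r + a) * p) = r * L p + L (a * p) := by
    intro r a p
    rw [add_mul, hadd, ← Algebra.smul_def, hsmul]
  have hneg : ∀ a, L (-a) = - L a := fun a => by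
    rw [← neg_one_smul ℝ a, hsmul]; ring
  have key : ∀ h ∈ T, 0 < L h → ∀ p, L (h * p) = L h * L p := by
    intro h hh hLh p
    obtain ⟨N₀, hN₀⟩ := harch h
    obtain ⟨N, hN, hNL⟩ : ∃ N : ℝ, algebraMap ℝ R N - h ∈ T ∧ L h < N := by
      refine ⟨N₀ + 1, ?_, ?_⟩
      · have := T.add_mem hN₀ (hT 1 zero_le_one)
        convert this using 1
        rw [map_add]; ring
      · have := hpos _ (hTQ _ hN₀)
        have h2 := hsub N₀ (-h) 1
        rw [mul_one, mul_one, ← sub_eq_add_neg, hneg, hL1] at h2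
        linarith
    have hNpos : 0 < N := hLh.trans hNL
    have hsub' : ∀ p, L ((algebraMap ℝ R N - h) * p) = N * L p - L (h * p) := by
      intro p
      have := hsub N (-h) p
      rw [neg_mul, hneg] at this
      rw [sub_eq_add_neg, this]; ring
    have mem : ∀ g ∈ T, 0 < L g → (fun p => L (g * p) / L g) ∈ stateSet Q := by
      intro g hg hLg
      refine ⟨fun a b => ?_, fun r a => ?_, fun q hq => ?_, ?_⟩
      · simp only [mul_add, hadd, add_div]
      · simp only [mul_smul_comm, hsmul, mul_div_assoc]
      · exact div_nonneg (hpos _ (hmul _ hg _ hq)) hLg.le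
      · simp only [mul_one]; exact div_self hLg.ne'
    have hLg : L (algebraMap ℝ R N - h) = N - L h := by
      have := hsub' 1
      rwa [mul_one, mul_one, hL1, mul_one] at this
    have hd : 0 < N - L h := by linarith
    have := hext (mem h hh hLh) (mem _ hN (by rw [hLg]; exact hd))
      ⟨L h / N, (N - L h) / N, by positivity, by positivity, by field_simp; ring, ?_⟩
    · have := congrFun this p
      rw [← this]; field_simp
    · funext p
      simp only [Pi.add_apply, Pi.smul_apply, smul_eq_mul, hsub', hLg]
      field_simp
      ring
  obtain ⟨N, hN⟩ := harch (-a)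
  have hN1 : algebraMap ℝ R (N + 1) + a ∈ T := by
    have := T.add_mem hN (hT 1 zero_le_one)
    convert this using 1
    rw [map_add]; ring
  have e1 := hsub (N + 1) a 1
  rw [mul_one, mul_one, hL1] at e1
  have e0 := hsub N a 1
  rw [mul_one, mul_one, hL1] at e0
  have hp0 := hpos _ (hTQ _ hN)
  rw [sub_neg_eq_add] at hp0
  have := key _ hN1 (by linarith) p
  rw [hsub, e1] at this
  linarith

/-- If `f` does not belong to `Q`, then the Riesz extension theorem yields a state of `Q` that is
nonpositive at `f`. -/
theorem exists_mem_stateSet_nonpos {T : Subsemiring R} {Q : AddSubmonoid R}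
    (harch : ∀ a : R, ∃ N : ℝ, algebraMap ℝ R N - a ∈ T)
    (hone : (1 : R) ∈ Q) (hmul : ∀ t ∈ T, ∀ q ∈ Q, t * q ∈ Q)
    (hT : ∀ r : ℝ, 0 ≤ r → algebraMap ℝ R r ∈ T) {f : R} (hf : f ∉ Q) :
    ∃ L ∈ stateSet Q, L f ≤ 0 := by
  have hTQ : ∀ t ∈ T, t ∈ Q := fun t ht => by simpa using hmul t ht 1 hone
  have hQs : ∀ r : ℝ, 0 ≤ r → ∀ q ∈ Q, r • q ∈ Q := fun r hr q hq => by
    rw [Algebra.smul_def]; exact hmul _ (hT r hr) _ hq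
  have h10 : (1 : R) ≠ 0 := by
    intro h
    have : Subsingleton R := subsingleton_of_zero_eq_one h.symm
    exact hf (Subsingleton.elim 0 f ▸ Q.zero_mem)
  let C : PointedCone ℝ R :=
    { carrier := {a | ∃ q ∈ Q, ∃ t : ℝ, 0 ≤ t ∧ a = q - t • f}
      zero_mem' := ⟨0, Q.zero_mem, 0, le_rfl, by simp⟩
      add_mem' := by
        rintro _ _ ⟨q, hq, t, ht, rfl⟩ ⟨q', hq', t', ht', rfl⟩
        exact ⟨q + q', Q.add_mem hq hq', t + t', add_nonneg ht ht', by rw [add_smul]; abel⟩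
      smul_mem' := by
        rintro ⟨r, hr⟩ _ ⟨q, hq, t, ht, rfl⟩
        refine ⟨r • q, hQs r hr q hq, r * t, mul_nonneg hr ht, ?_⟩
        change r • (q - t • f) = _
        rw [smul_sub, smul_smul] }
  have hC : ∀ a, a ∈ C ↔ ∃ q ∈ Q, ∃ t : ℝ, 0 ≤ t ∧ a = q - t • f := fun a => Iff.rfl
  have hneg1 : ∀ c : ℝ, c < 0 → c • (1 : R) ∉ Q := by
    intro c hc hcQ
    obtain ⟨N, hN⟩ := harch (-f)
    have h1 : (|N| / (-c)) • (c • (1 : R)) ∈ Q :=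
      hQs _ (div_nonneg (abs_nonneg N) (by linarith)) _ hcQ
    have h2 : (|N| - N) • (1 : R) ∈ Q := hQs _ (by linarith [le_abs_self N]) _ hone
    apply hf
    have := Q.add_mem (Q.add_mem (hTQ _ hN) h1) h2
    convert this using 1
    rw [smul_smul, div_mul_eq_mul_div, mul_comm |N|, div_neg, mul_div_cancel_left₀ _ hc.ne,
      Algebra.algebraMap_eq_smul_one, sub_smul, neg_smul]
    abel
  obtain ⟨g, hg, hgC⟩ := riesz_extension C (LinearPMap.mkSpanSingleton (1 : R) (1 : ℝ) h10)
    (by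
      rintro ⟨x, hx⟩ hxC
      obtain ⟨c, rfl⟩ := Submodule.mem_span_singleton.1 hx
      have hval := LinearPMap.mkSpanSingleton'_apply (1 : R) (1 : ℝ)
        (fun c hc => by simpa [h10] using hc) c hx
      change 0 ≤ LinearPMap.mkSpanSingleton' (1 : R) (1 : ℝ) _ ⟨c • (1 : R), hx⟩
      rw [hval, RingHom.id_apply, smul_eq_mul, mul_one]
      by_contra! hc
      obtain ⟨q, hq, t, ht, h⟩ := hxC
      simp only at h
      rcases ht.eq_or_lt with rfl | ht
      · rw [zero_smul, sub_zero] at h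
        exact hneg1 c hc (h ▸ hq)
      · apply hf
        have h3 : f = t⁻¹ • (q + (-c) • (1 : R)) := by
          rw [neg_smul, h, eq_inv_smul_iff₀ ht.ne']; abel
        rw [h3]
        exact hQs _ (by positivity) _ (Q.add_mem hq (hQs _ (by linarith) _ hone)))
    (by
      intro y
      obtain ⟨N, hN⟩ := harch (-y)
      refine ⟨⟨N • (1 : R), Submodule.mem_span_singleton.2 ⟨N, rfl⟩⟩, ?_⟩
      rw [hC]
      refine ⟨_, hTQ _ hN, 0, le_rfl, ?_⟩
      simp [Algebra.algebraMap_eq_smul_one])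
  refine ⟨g, ⟨map_add g, fun r a => by simp, fun q hq => hgC _ ⟨q, hq, 0, le_rfl, by simp⟩, ?_⟩, ?_⟩
  · have := hg ⟨1, Submodule.mem_span_singleton_self 1⟩
    rw [this]
    simpa using LinearPMap.mkSpanSingleton_apply ℝ ℝ h10 (1 : ℝ)
  · have := hgC (-f) ⟨0, Q.zero_mem, 1, zero_le_one, by simp⟩
    rw [map_neg] at this
    linarith

/-- **Representation theorem** of Kadison–Dubois and Jacobi, for a module `Q` over an archimedean
preordering `T`: an element that is positive at every real character of `R` nonnegative on `Q`
belongs to `Q`. -/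
theorem mem_of_forall_algHom_pos {T : Subsemiring R} {Q : AddSubmonoid R}
    (harch : ∀ a : R, ∃ N : ℝ, algebraMap ℝ R N - a ∈ T)
    (hone : (1 : R) ∈ Q) (hmul : ∀ t ∈ T, ∀ q ∈ Q, t * q ∈ Q)
    (hT : ∀ r : ℝ, 0 ≤ r → algebraMap ℝ R r ∈ T) {f : R}
    (hf : ∀ φ : R →ₐ[ℝ] ℝ, (∀ q ∈ Q, 0 ≤ φ q) → 0 < φ f) : f ∈ Q := by
  by_contra hfQ
  obtain ⟨g, hgS, hgf⟩ := exists_mem_stateSet_nonpos harch hone hmul hT hfQ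
  have hcomp : IsCompact (stateSet Q) := isCompact_stateSet fun a => by
    obtain ⟨N, hN⟩ := harch a
    exact ⟨N, by simpa using hmul _ hN 1 hone⟩
  -- The states minimizing `L f` form an exposed face; an extreme point of it is an extreme state.
  let l : StrongDual ℝ (R → ℝ) := -ContinuousLinearMap.proj (R := ℝ) (φ := fun _ : R => ℝ) f
  have hexp : IsExposed ℝ (stateSet Q) {L ∈ stateSet Q | ∀ L' ∈ stateSet Q, l L' ≤ l L} :=
    fun _ => ⟨l, rfl⟩
  obtain ⟨L₀, hL₀, hmin⟩ := hcomp.exists_isMaxOn ⟨g, hgS⟩ l.continuous.continuousOn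
  obtain ⟨L, hL⟩ := (hexp.isCompact hcomp).extremePoints_nonempty ⟨L₀, hL₀, hmin⟩
  have hLf : L f ≤ 0 := by
    have := hL.1.2 g hgS
    simp only [l, neg_apply, ContinuousLinearMap.proj_apply] at this
    linarith
  have hLext := hexp.isExtreme.extremePoints_subset_extremePoints hL
  obtain ⟨hadd, hsmul, hpos, hL1⟩ := hLext.1
  let Llin : R →ₗ[ℝ] ℝ := { toFun := L, map_add' := hadd, map_smul' := hsmul }
  have := hf (AlgHom.ofLinearMap Llin hL1
    (map_mul_of_mem_extremePoints_stateSet harch hone hmul hT hLext)) hpos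
  exact absurd this (not_lt.2 hLf)

end Representation

/-! ### Putinar's theorem on the sphere -/

open MvPolynomial in
/-- The preordering `Σ[x] + (‖x‖² - 1) ℝ[x]`, consisting of the sums of squares modulo the ideal of
the unit sphere. -/
def spherePreordering (N : ℕ) : Subsemiring (MvPolynomial (Fin N) ℝ) where
  carrier := {p | ∃ s r, IsSumSq s ∧ p = s + (∑ i, X i ^ 2 - 1) * r}
  mul_mem' := by
    rintro _ _ ⟨s, r, hs, rfl⟩ ⟨s', r', hs', rfl⟩
    exact ⟨s * s', s * r' + r * s' + (∑ i, X i ^ 2 - 1) * r * r', hs.mul hs', by ring⟩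
  one_mem' := ⟨1, 0, IsSumSq.one, by ring⟩
  add_mem' := by
    rintro _ _ ⟨s, r, hs, rfl⟩ ⟨s', r', hs', rfl⟩
    exact ⟨s + s', r + r', hs.add hs', by ring⟩
  zero_mem' := ⟨0, 0, .zero, by ring⟩

theorem isSumSq_C {N : ℕ} {r : ℝ} (hr : 0 ≤ r) :
    IsSumSq (MvPolynomial.C r : MvPolynomial (Fin N) ℝ) := by
  rw [← Real.mul_self_sqrt hr, map_mul]
  exact IsSumSq.mul_self _

theorem IsSumSq.mem_spherePreordering {N : ℕ} {s : MvPolynomial (Fin N) ℝ} (hs : IsSumSq s) :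
    s ∈ spherePreordering N := ⟨s, 0, hs, by ring⟩

theorem C_mem_spherePreordering {N : ℕ} {r : ℝ} (hr : 0 ≤ r) :
    MvPolynomial.C r ∈ spherePreordering N := (isSumSq_C hr).mem_spherePreordering

open MvPolynomial in
/-- The sphere is compact: its preordering contains `c - p` for some real `c`. The bounded elements
form a subalgebra, and each coordinate is bounded since `1 - x_i²` is a sum of squares on the
sphere. -/
theorem exists_C_sub_mem_spherePreordering {N : ℕ} (p : MvPolynomial (Fin N) ℝ) :
    ∃ c : ℝ, C c - p ∈ spherePreordering N := by
  have half : ∀ q : MvPolynomial (Fin N) ℝ, C 2 * q ∈ spherePreordering N →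
      q ∈ spherePreordering N := by
    intro q hq
    have := (spherePreordering N).mul_mem
      (C_mem_spherePreordering (N := N) (by norm_num : (0 : ℝ) ≤ 2⁻¹)) hq
    rwa [← mul_assoc, ← map_mul, inv_mul_cancel₀ two_ne_zero, map_one, one_mul] at this
  have C2 : (C 2 : MvPolynomial (Fin N) ℝ) = 2 := map_ofNat C 2
  suffices h : ∃ c : ℝ, C c - p ∈ spherePreordering N ∧ C c + p ∈ spherePreordering N from
    h.imp fun _ h => h.1
  have hmul : ∀ (p q : MvPolynomial (Fin N) ℝ),
      (∃ c : ℝ, C c - p ∈ spherePreordering N ∧ C c + p ∈ spherePreordering N) →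
      (∃ c : ℝ, C c - q ∈ spherePreordering N ∧ C c + q ∈ spherePreordering N) →
      ∃ c : ℝ, C c - p * q ∈ spherePreordering N ∧ C c + p * q ∈ spherePreordering N := by
    rintro p q ⟨c, hc, hc'⟩ ⟨d, hd, hd'⟩
    refine ⟨c * d, half _ ?_, half _ ?_⟩
    · have := add_mem (mul_mem hc' hd) (mul_mem hc hd')
      convert this using 1
      rw [C2, map_mul]; ring
    · have := add_mem (mul_mem hc hd) (mul_mem hc' hd')
      convert this using 1
      rw [C2, map_mul]; ring
  induction p using MvPolynomial.induction_on with
  | C a =>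
    refine ⟨|a|, ?_, ?_⟩
    · rw [← map_sub]; exact C_mem_spherePreordering (by linarith [le_abs_self a])
    · rw [← map_add]; exact C_mem_spherePreordering (by linarith [neg_abs_le a])
  | add p q hp hq =>
    obtain ⟨c, hc, hc'⟩ := hp
    obtain ⟨d, hd, hd'⟩ := hq
    refine ⟨c + d, ?_, ?_⟩
    · convert add_mem hc hd using 1
      rw [map_add]; ring
    · convert add_mem hc' hd' using 1
      rw [map_add]; ring
  | mul_X p i hp =>
    refine hmul p (X i) hp ⟨1, half _ ?_, half _ ?_⟩
    all_goals
      have h1 : (1 : MvPolynomial (Fin N) ℝ) - X i ^ 2 ∈ spherePreordering N := by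
        refine ⟨∑ j ∈ Finset.univ.erase i, X j ^ 2, -1, IsSumSq.sum_sq _ _, ?_⟩
        rw [← Finset.add_sum_erase _ _ (Finset.mem_univ i)]; ring
    · convert add_mem h1 (IsSumSq.mul_self (1 - X i)).mem_spherePreordering using 1
      rw [C2, map_one]; ring
    · convert add_mem h1 (IsSumSq.mul_self (1 + X i)).mem_spherePreordering using 1
      rw [C2, map_one]; ring

/-- The sum of the ideal generated by the `h i` and of the quadratic module generated by the `g j`,
without degree bounds. -/
def idealQM {N : ℕ} {ι κ : Type*} [Fintype ι] [Fintype κ] (h : ι → MvPolynomial (Fin N) ℝ)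
    (g : κ → MvPolynomial (Fin N) ℝ) : AddSubmonoid (MvPolynomial (Fin N) ℝ) where
  carrier := {p | ∃ (r : ι → MvPolynomial (Fin N) ℝ) (s₀ : MvPolynomial (Fin N) ℝ)
    (s : κ → MvPolynomial (Fin N) ℝ), IsSumSq s₀ ∧ (∀ j, IsSumSq (s j)) ∧
    p = ∑ i, h i * r i + (s₀ + ∑ j, g j * s j)}
  zero_mem' := ⟨0, 0, 0, .zero, fun _ => .zero, by simp⟩
  add_mem' := by
    rintro _ _ ⟨r, s₀, s, hs₀, hs, rfl⟩ ⟨r', s₀', s', hs₀', hs', rfl⟩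
    refine ⟨r + r', s₀ + s₀', s + s', hs₀.add hs₀', fun j => (hs j).add (hs' j), ?_⟩
    simp only [Pi.add_apply, mul_add, Finset.sum_add_distrib]
    ring

open MvPolynomial in
theorem mul_mem_idealQM {N : ℕ} {ι κ : Type*} [Fintype ι] [Fintype κ]
    {h : ι → MvPolynomial (Fin N) ℝ} {g : κ → MvPolynomial (Fin N) ℝ} {i₀ : ι}
    (hi₀ : h i₀ = ∑ i, X i ^ 2 - 1) {t q : MvPolynomial (Fin N) ℝ}
    (ht : t ∈ spherePreordering N) (hq : q ∈ idealQM h g) : t * q ∈ idealQM h g := by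
  classical
  obtain ⟨u, v, hu, rfl⟩ := ht
  obtain ⟨r, s₀, s, hs₀, hs, rfl⟩ := hq
  refine ⟨fun i => u * r i + if i = i₀ then v * (∑ i, h i * r i + (s₀ + ∑ j, g j * s j)) else 0,
    u * s₀, fun j => u * s j, hu.mul hs₀, fun j => hu.mul (hs j), ?_⟩
  simp only [mul_add, Finset.sum_add_distrib, mul_ite, mul_zero, Finset.sum_ite_eq',
    Finset.mem_univ, if_true, mul_left_comm _ u, ← Finset.mul_sum, hi₀]
  ring

open MvPolynomial in
/-- **Putinar's Positivstellensatz** on subsets of the unit sphere: a polynomial that is positive on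
`{h = 0, g ≥ 0}`, where the sphere equation occurs among the `h i`, lies in the sum of the ideal of
`h` and the quadratic module of `g`. -/
theorem mem_idealQM_of_pos {N : ℕ} {ι κ : Type*} [Fintype ι] [Fintype κ]
    {h : ι → MvPolynomial (Fin N) ℝ} {g : κ → MvPolynomial (Fin N) ℝ} {i₀ : ι}
    (hi₀ : h i₀ = ∑ i, X i ^ 2 - 1) {f : MvPolynomial (Fin N) ℝ}
    (hf : ∀ x ∈ semialgSet h g, 0 < eval x f) : f ∈ idealQM h g := by
  classical
  refine mem_of_forall_algHom_pos (Q := idealQM h g) exists_C_sub_mem_spherePreordering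
    ⟨0, 1, 0, .one, fun _ => .zero, by simp⟩ (fun t ht q hq => mul_mem_idealQM hi₀ ht hq)
    (fun r hr => C_mem_spherePreordering hr) fun φ hφ => ?_
  have hev : ∀ p, φ p = eval (φ ∘ X) p := fun p => by
    rw [← coe_aeval_eq_eval]
    exact DFunLike.congr_fun (aeval_unique φ) p
  have hmem : ∀ i r, h i * r ∈ idealQM h g := fun i r =>
    ⟨Pi.single i r, 0, 0, .zero, fun _ => .zero, by simp [Pi.single_apply]⟩
  rw [hev]
  refine hf _ ⟨fun i => ?_, fun j => ?_⟩
  · have h1 := hφ _ (hmem i 1)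
    have h2 := hφ _ (hmem i (-1))
    rw [mul_neg, map_neg] at h2
    rw [mul_one] at h1 h2
    rw [← hev]
    linarith
  · rw [← hev]
    refine hφ _ ⟨0, 0, Pi.single j 1, .zero, fun j' => ?_, by simp [Pi.single_apply]⟩
    rcases eq_or_ne j' j with rfl | hj
    · simp
    · rw [Pi.single_eq_of_ne hj]; exact .zero

/-! ### Homogenization and positivity at infinity -/

section Homogenization

open MvPolynomial

variable {n : ℕ}

/-- The homogenization `x₀^d p(x/x₀)` of `p` in a prescribed degree `d ≥ deg p`. -/
def homPoly (d : ℕ) (p : MvPolynomial (Fin n) ℝ) : MvPolynomial (Fin (n + 1)) ℝ :=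
  ∑ α ∈ p.support, monomial (homExp d α) (p.coeff α)

theorem eval_monomial_homExp (d : ℕ) (α : Fin n →₀ ℕ) (c : ℝ) (z : Fin (n + 1) → ℝ) :
    eval z (monomial (homExp d α) c) = c * (z 0 ^ (d - α.degree) * ∏ i, z i.succ ^ α i) := by
  rw [eval_monomial, Finsupp.prod_fintype _ _ (by simp), Fin.prod_univ_succ]
  simp [homExp]

theorem eval_homPoly {d : ℕ} {p : MvPolynomial (Fin n) ℝ} (hp : p.totalDegree ≤ d)
    {z : Fin (n + 1) → ℝ} (hz : z 0 ≠ 0) :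
    eval z (homPoly d p) = z 0 ^ d * eval (fun i => z i.succ / z 0) p := by
  rw [homPoly, map_sum, eval_eq' _ p, Finset.mul_sum]
  refine Finset.sum_congr rfl fun α hα => ?_
  have hαd : α.degree ≤ d := by
    rw [Finsupp.degree_apply]; exact (le_totalDegree hα).trans hp
  rw [eval_monomial_homExp]
  simp only [div_pow, Finset.prod_div_distrib, Finset.prod_pow_eq_pow_sum]
  have : ∑ i, α i = α.degree := by rw [Finsupp.degree_eq_sum]
  rw [this, ← Nat.sub_add_cancel hαd, Nat.add_sub_cancel, pow_add]
  field_simp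

theorem homogenization_eq_homPoly (p : MvPolynomial (Fin n) ℝ) :
    homogenization p = homPoly p.totalDegree p := rfl

/-- Raising the degree of the homogenization multiplies it by a power of `x₀`. -/
theorem eval_homPoly_eq_pow_mul {d e : ℕ} {p : MvPolynomial (Fin n) ℝ} (hp : p.totalDegree ≤ e)
    (hed : e ≤ d) (z : Fin (n + 1) → ℝ) :
    eval z (homPoly d p) = z 0 ^ (d - e) * eval z (homPoly e p) := by
  simp only [homPoly, map_sum, Finset.mul_sum]
  refine Finset.sum_congr rfl fun α hα => ?_
  have hαd : α.degree ≤ e := by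
    rw [Finsupp.degree_apply]; exact (le_totalDegree hα).trans hp
  rw [eval_monomial_homExp, eval_monomial_homExp,
    show d - α.degree = (d - e) + (e - α.degree) by omega, pow_add]
  ring

variable {E I : Type*} {cE : E → MvPolynomial (Fin n) ℝ} {cI : I → MvPolynomial (Fin n) ℝ}

/-- Off the hyperplane at infinity, the homogenized set is the cone over `K`. -/
theorem mem_homSet_iff_of_pos {z : Fin (n + 1) → ℝ} (hz : 0 < z 0) :
    z ∈ homSet cE cI ↔ (fun i => z i.succ / z 0) ∈ semialgSet cE cI := by
  simp only [homSet, semialgSet, Set.mem_inter_iff, Set.mem_ofPred_eq, homogenization_eq_homPoly,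
    eval_homPoly le_rfl hz.ne', mul_eq_zero, pow_eq_zero_iff', hz.ne', false_and, false_or,
    mul_nonneg_iff_of_pos_left (pow_pos hz _), hz.le, and_true]

/-- Being closed at infinity transfers inequalities from `K` to the whole homogenized set. -/
theorem mul_eval_homPoly_le (hclosed : ClosedAtInfinity cE cI) {d : ℕ}
    {p q : MvPolynomial (Fin n) ℝ} (hp : p.totalDegree ≤ d) (hq : q.totalDegree ≤ d) {c : ℝ}
    (h : ∀ x ∈ semialgSet cE cI, c * eval x p ≤ eval x q) {z : Fin (n + 1) → ℝ}
    (hz : z ∈ homSet cE cI) : c * eval z (homPoly d p) ≤ eval z (homPoly d q) := by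
  have hcl : IsClosed {z | c * eval z (homPoly d p) ≤ eval z (homPoly d q)} :=
    isClosed_le (continuous_const.mul (MvPolynomial.continuous_eval _))
      (MvPolynomial.continuous_eval _)
  rw [← hclosed] at hz
  refine closure_minimal ?_ hcl hz
  rintro z ⟨hzK, hz0⟩
  have hz0 : 0 < z 0 := hz0
  have := h _ ((mem_homSet_iff_of_pos hz0).1 hzK)
  rw [Set.mem_ofPred_eq, eval_homPoly hp hz0.ne', eval_homPoly hq hz0.ne', mul_left_comm]
  exact mul_le_mul_of_nonneg_left this (pow_pos hz0 _).le

theorem mem_semialgSet_homEq_homIneq {z : Fin (n + 1) → ℝ} :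
    z ∈ semialgSet (homEq cE) (homIneq cI) ↔ z ∈ homSet cE cI ∧ ∑ i, z i ^ 2 = 1 := by
  simp only [semialgSet, homSet, Set.mem_ofPred_eq, Set.mem_inter_iff, Option.forall, homEq,
    homIneq, map_sub, map_sum, map_pow, eval_X, map_one, sub_eq_zero]
  tauto

theorem isClosed_semialgSet {N : ℕ} {ι κ : Type*} (h : ι → MvPolynomial (Fin N) ℝ)
    (g : κ → MvPolynomial (Fin N) ℝ) : IsClosed (semialgSet h g) := by
  simp only [semialgSet, Set.ofPred_and, Set.ofPred_forall]
  exact (isClosed_iInter fun i => isClosed_eq (MvPolynomial.continuous_eval _)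
    continuous_const).inter (isClosed_iInter fun i => isClosed_le continuous_const
      (MvPolynomial.continuous_eval _))

theorem abs_le_one_of_sum_sq_eq_one {ι : Type*} [Fintype ι] {z : ι → ℝ} (hz : ∑ i, z i ^ 2 = 1)
    (i : ι) : |z i| ≤ 1 := by
  rw [← sq_le_one_iff_abs_le_one, ← hz]
  exact Finset.single_le_sum (f := fun i => z i ^ 2) (fun i _ => sq_nonneg _) (Finset.mem_univ i)

theorem isCompact_semialgSet_homEq_homIneq :
    IsCompact (semialgSet (homEq cE) (homIneq cI)) := by
  refine (isCompact_univ_pi fun _ => isCompact_Icc (a := (-1 : ℝ)) (b := 1)).of_isClosed_subset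
    (isClosed_semialgSet _ _) fun z hz i _ => ?_
  exact abs_le.1 (abs_le_one_of_sum_sq_eq_one (mem_semialgSet_homEq_homIneq.1 hz).2 i)

/-! ### Interior points of cones of nonnegative polynomials -/

theorem mem_polyA_iff {A : Finset (Fin n →₀ ℕ)} {p : MvPolynomial (Fin n) ℝ} :
    p ∈ polyA A ↔ p.support ⊆ A := by
  rw [polyA, mem_restrictSupport_iff, Finset.coe_subset]

theorem coeff_eq_zero_of_mem_polyA {A : Finset (Fin n →₀ ℕ)} {p : MvPolynomial (Fin n) ℝ}
    (hp : p ∈ polyA A) {α : Fin n →₀ ℕ} (hα : α ∉ A) : p.coeff α = 0 :=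
  notMem_support_iff.1 fun h => hα (mem_polyA_iff.1 hp h)

theorem totalDegree_le_expDeg {A : Finset (Fin n →₀ ℕ)} {p : MvPolynomial (Fin n) ℝ}
    (hp : p ∈ polyA A) : p.totalDegree ≤ expDeg A := by
  refine Finset.sup_le fun α hα => ?_
  exact Finset.le_sup (f := Finsupp.degree) (mem_polyA_iff.1 hp hα)

/-- An interior point `q` of the cone of nonnegative polynomials dominates, on `K`, a positive
multiple of any polynomial in the space. -/
theorem exists_pos_mul_eval_le {A : Finset (Fin n →₀ ℕ)} {K : Set (Fin n → ℝ)}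
    {p q : MvPolynomial (Fin n) ℝ} (hq : q ∈ interiorA A (nonnegCone A K)) (hp : p ∈ polyA A) :
    ∃ ε > 0, ∀ x ∈ K, ε * eval x p ≤ eval x q := by
  obtain ⟨hqA, hq⟩ := hq
  have hcont : Filter.Tendsto (fun ε : ℝ => coeffVec A q - ε • coeffVec A p)
      (nhdsWithin 0 (Set.Ioi 0)) (nhds (coeffVec A q)) := by
    have : Continuous fun ε : ℝ => coeffVec A q - ε • coeffVec A p := by fun_prop
    have := this.tendsto 0
    rw [zero_smul, sub_zero] at this
    exact this.mono_left nhdsWithin_le_nhds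
  obtain ⟨ε, hε, hε0⟩ := ((hcont.eventually (mem_interior_iff_mem_nhds.1 hq)).and
    self_mem_nhdsWithin).exists
  refine ⟨ε, hε0, fun x hx => ?_⟩
  obtain ⟨r, ⟨hrA, hr⟩, hrv⟩ := hε
  have hreq : r = q - ε • p := by
    ext α
    rw [coeff_sub, coeff_smul]
    by_cases hα : α ∈ A
    · exact congrFun hrv ⟨α, hα⟩
    · rw [coeff_eq_zero_of_mem_polyA hrA hα, coeff_eq_zero_of_mem_polyA hqA hα,
        coeff_eq_zero_of_mem_polyA hp hα]
      simp
  have := hr x hx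
  rw [hreq, map_sub, smul_eval] at this
  linarith

/-- An interior point of `P_d(K)` has a positive homogenization on the spherical part of the
homogenized set, including the points at infinity. -/
theorem eval_homPoly_pos_of_mem_interiorA (hclosed : ClosedAtInfinity cE cI) {d : ℕ}
    {q : MvPolynomial (Fin n) ℝ}
    (hq : q ∈ interiorA (expLE n d) (nonnegCone (expLE n d) (semialgSet cE cI)))
    (hqd : q.totalDegree ≤ d) {z : Fin (n + 1) → ℝ}
    (hz : z ∈ semialgSet (homEq cE) (homIneq cI)) : 0 < eval z (homPoly d q) := by
  obtain ⟨hzK, hz1⟩ := mem_semialgSet_homEq_homIneq.1 hz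
  have key : ∀ α : Fin n →₀ ℕ, α.degree ≤ d →
      z 0 ^ (d - α.degree) * ∏ i, z i.succ ^ α i ≠ 0 → 0 < eval z (homPoly d q) := by
    intro α hα h0
    have hmem : (monomial α (1 : ℝ)) ∈ polyA (expLE n d) :=
      (monomial_mem_restrictSupport ℝ).2 (Or.inl (mem_expLE.2 hα))
    have hdeg : (monomial α (1 : ℝ)).totalDegree ≤ d := by
      rw [totalDegree_monomial _ one_ne_zero]; exact hα
    have hev : eval z (homPoly d (monomial α (1 : ℝ))) =
        z 0 ^ (d - α.degree) * ∏ i, z i.succ ^ α i := by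
      rw [homPoly, support_monomial, if_neg one_ne_zero, Finset.sum_singleton, coeff_monomial,
        if_pos rfl, eval_monomial_homExp, one_mul]
    obtain ⟨ε, hε, h⟩ := exists_pos_mul_eval_le hq hmem
    obtain ⟨δ, hδ, h'⟩ := exists_pos_mul_eval_le hq (neg_mem hmem)
    have h1 := mul_eval_homPoly_le hclosed hdeg hqd h hzK
    have h2 := mul_eval_homPoly_le hclosed (c := -δ) hdeg hqd
      (fun x hx => by simpa using h' x hx) hzK
    rw [hev] at h1 h2
    rcases lt_or_gt_of_ne h0 with h0 | h0
    · nlinarith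
    · nlinarith
  obtain ⟨i, hi⟩ : ∃ i, z i ≠ 0 := by
    by_contra! h
    simp [h] at hz1
  induction i using Fin.cases with
  | zero => exact key 0 (by simp) (by simpa using pow_ne_zero d hi)
  | succ j =>
    refine key (Finsupp.single j d) (by simp) ?_
    rw [Finset.prod_eq_single j (fun i _ hij => by simp [hij.symm])
      (by simp)]
    simpa using fun h => absurd h hi

theorem exists_pos_le_of_isCompact {X : Type*} [TopologicalSpace X] {S : Set X} (hS : IsCompact S)
    {f : X → ℝ} (hf : ContinuousOn f S) (hpos : ∀ z ∈ S, 0 < f z) :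
    ∃ ε > 0, ∀ z ∈ S, ε ≤ f z := by
  rcases S.eq_empty_or_nonempty with rfl | hne
  · exact ⟨1, one_pos, by simp⟩
  · obtain ⟨z, hz, hmin⟩ := hS.exists_isMinOn hne hf
    exact ⟨f z, hpos z hz, fun w hw => hmin hw⟩

/-- The Euclidean norm of the point `(1, x)`. -/
def liftNorm (x : Fin n → ℝ) : ℝ := √(1 + ∑ i, x i ^ 2)

/-- The central projection `(1, x) / ‖(1, x)‖` of `x` to the unit sphere. -/
def sphereLift (x : Fin n → ℝ) : Fin (n + 1) → ℝ := fun i =>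
  (Fin.cons 1 x : Fin (n + 1) → ℝ) i / liftNorm x

theorem liftNorm_pos (x : Fin n → ℝ) : 0 < liftNorm x :=
  Real.sqrt_pos.2 (by positivity)

@[fun_prop]
theorem continuous_liftNorm : Continuous (liftNorm (n := n)) := by
  unfold liftNorm; fun_prop

@[fun_prop]
theorem continuous_sphereLift : Continuous (sphereLift (n := n)) := by
  refine continuous_pi fun i => Continuous.div ?_ continuous_liftNorm fun x => (liftNorm_pos x).ne'
  induction i using Fin.cases <;> simp <;> fun_prop

theorem sphereLift_zero (x : Fin n → ℝ) : sphereLift x 0 = (liftNorm x)⁻¹ := by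
  simp [sphereLift]

theorem sphereLift_succ (x : Fin n → ℝ) (i : Fin n) :
    sphereLift x i.succ = x i / liftNorm x := by
  simp [sphereLift]

theorem sum_sq_sphereLift (x : Fin n → ℝ) : ∑ i, sphereLift x i ^ 2 = 1 := by
  have h : liftNorm x ^ 2 = 1 + ∑ i, x i ^ 2 := Real.sq_sqrt (by positivity)
  have h0 : liftNorm x ^ 2 ≠ 0 := pow_ne_zero _ (liftNorm_pos x).ne'
  simp only [Fin.sum_univ_succ, sphereLift_zero, sphereLift_succ, div_pow, ← Finset.sum_div,
    inv_pow]
  rw [← one_div, ← add_div, ← h, div_self h0]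

theorem sphereLift_div (x : Fin n → ℝ) : (fun i => sphereLift x i.succ / sphereLift x 0) = x := by
  funext i
  have := (liftNorm_pos x).ne'
  rw [sphereLift_zero, sphereLift_succ]
  field_simp

theorem sphereLift_zero_pos (x : Fin n → ℝ) : 0 < sphereLift x 0 := by
  rw [sphereLift_zero]; exact inv_pos.2 (liftNorm_pos x)

theorem sphereLift_mem {x : Fin n → ℝ} (hx : x ∈ semialgSet cE cI) :
    sphereLift x ∈ semialgSet (homEq cE) (homIneq cI) := by
  refine mem_semialgSet_homEq_homIneq.2
    ⟨(mem_homSet_iff_of_pos (sphereLift_zero_pos x)).2 ?_, sum_sq_sphereLift x⟩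
  rwa [sphereLift_div]

theorem eval_sphereLift_homPoly {d : ℕ} {p : MvPolynomial (Fin n) ℝ} (hp : p.totalDegree ≤ d)
    (x : Fin n → ℝ) : liftNorm x ^ d * eval (sphereLift x) (homPoly d p) = eval x p := by
  rw [eval_homPoly hp (sphereLift_zero_pos x).ne', sphereLift_div, sphereLift_zero, ← mul_assoc,
    ← mul_pow, mul_inv_cancel₀ (liftNorm_pos x).ne', one_pow, one_mul]

end Homogenization

/-! ### Riesz functionals and localizing matrices -/

section Riesz

open MvPolynomial

variable {N m : ℕ}

theorem riesz_sum {ι : Type*} (s : Finset ι) (f : ι → MvPolynomial (Fin N) ℝ)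
    (w : expLE N m → ℝ) : riesz w (∑ i ∈ s, f i) = ∑ i ∈ s, riesz w (f i) := by
  simp only [riesz, coeff_sum, Finset.sum_mul]
  exact Finset.sum_comm

theorem riesz_add (w : expLE N m → ℝ) (p q : MvPolynomial (Fin N) ℝ) :
    riesz w (p + q) = riesz w p + riesz w q := by
  simp only [riesz, coeff_add, add_mul, Finset.sum_add_distrib]

theorem riesz_smul (w : expLE N m → ℝ) (c : ℝ) (p : MvPolynomial (Fin N) ℝ) :
    riesz w (c • p) = c * riesz w p := by
  simp only [riesz, coeff_smul, smul_eq_mul, Finset.mul_sum, mul_assoc]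

theorem riesz_monomial (w : expLE N m → ℝ) {β : Fin N →₀ ℕ} (hβ : β ∈ expLE N m) (c : ℝ) :
    riesz w (monomial β c) = c * w ⟨β, hβ⟩ := by
  rw [riesz, Finset.sum_eq_single ⟨β, hβ⟩]
  · rw [coeff_monomial, if_pos rfl]
  · intro γ _ hγ
    rw [coeff_monomial, if_neg (fun h => hγ (Subtype.ext h.symm)), zero_mul]
  · simp

theorem continuous_riesz (p : MvPolynomial (Fin N) ℝ) :
    Continuous fun w : expLE N m → ℝ => riesz w p := by
  unfold riesz; fun_prop

theorem mem_polyA_expLE {p : MvPolynomial (Fin N) ℝ} :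
    p ∈ polyA (expLE N m) ↔ p.totalDegree ≤ m := by
  rw [mem_polyA_iff, totalDegree, Finset.sup_le_iff]
  refine forall₂_congr fun α _ => ?_
  rw [mem_expLE, Finsupp.degree_apply]; rfl

/-- The Riesz functional of a truncation of `w` agrees with that of `w` in low degrees. -/
theorem riesz_truncate {m' : ℕ} (hm : m ≤ m') (w : expLE N m' → ℝ) {p : MvPolynomial (Fin N) ℝ}
    (hp : p ∈ polyA (expLE N m)) :
    riesz (fun β : expLE N m => w ⟨β, mem_expLE.2 ((mem_expLE.1 β.2).trans hm)⟩) p =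
      riesz w p := by
  rw [← p.support_sum_monomial_coeff, riesz_sum, riesz_sum]
  refine Finset.sum_congr rfl fun β hβ => ?_
  have hβm := mem_polyA_iff.1 hp hβ
  rw [riesz_monomial _ hβm, riesz_monomial _ (mem_expLE.2 ((mem_expLE.1 hβm).trans hm))]

theorem mem_locIndex {k : ℕ} {q : MvPolynomial (Fin N) ℝ} {α : Fin N →₀ ℕ} :
    α ∈ locIndex k q ↔ q.totalDegree + 2 * α.degree ≤ 2 * k := by
  rw [locIndex, Finset.mem_filter, mem_expLE]
  exact ⟨fun h => h.2, fun h => ⟨by omega, h⟩⟩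

/-- The entries of the localizing matrix involve only polynomials of degree at most `2k`. -/
theorem mul_monomial_mem_polyA {k : ℕ} {q : MvPolynomial (Fin N) ℝ} (α β : locIndex k q) :
    q * monomial (α.1 + β.1) (1 : ℝ) ∈ polyA (expLE N (2 * k)) := by
  rw [mem_polyA_expLE]
  have hα := mem_locIndex.1 α.2
  have hβ := mem_locIndex.1 β.2
  refine (totalDegree_mul _ _).trans ?_
  rw [totalDegree_monomial _ one_ne_zero]
  change q.totalDegree + (α.1 + β.1).degree ≤ _
  rw [map_add]
  omega

/-- The polynomial whose coefficients are the entries of a vector indexed by the rows of a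
localizing matrix. -/
def polyOfVec {s : Finset (Fin N →₀ ℕ)} (v : s → ℝ) : MvPolynomial (Fin N) ℝ :=
  ∑ α, monomial α.1 (v α)

theorem mul_polyOfVec_sq {k : ℕ} {q : MvPolynomial (Fin N) ℝ} (v : locIndex k q → ℝ) :
    q * (polyOfVec v * polyOfVec v) =
      ∑ α, ∑ β, (v α * v β) • (q * monomial (α.1 + β.1) (1 : ℝ)) := by
  rw [polyOfVec, Finset.sum_mul_sum]
  simp only [Finset.mul_sum, monomial_mul]
  refine Finset.sum_congr rfl fun α _ => Finset.sum_congr rfl fun β _ => ?_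
  rw [← mul_smul_comm, smul_monomial, smul_eq_mul, mul_one]

theorem mul_polyOfVec_sq_mem_polyA {k : ℕ} {q : MvPolynomial (Fin N) ℝ} (v : locIndex k q → ℝ) :
    q * (polyOfVec v * polyOfVec v) ∈ polyA (expLE N (2 * k)) := by
  rw [mul_polyOfVec_sq]
  exact sum_mem fun α _ => sum_mem fun β _ => Submodule.smul_mem _ _ (mul_monomial_mem_polyA α β)

/-- A localizing matrix is positive semidefinite exactly when the Riesz functional is nonnegative at
all `q p²` of admissible degree. -/
theorem posSemidef_locMatrix_iff {k : ℕ} {q : MvPolynomial (Fin N) ℝ}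
    {w : expLE N (2 * k) → ℝ} : (locMatrix k q w).PosSemidef ↔
      ∀ v : locIndex k q → ℝ, 0 ≤ riesz w (q * (polyOfVec v * polyOfVec v)) := by
  rw [Matrix.posSemidef_iff_dotProduct_mulVec]
  have hsymm : (locMatrix k q w).IsHermitian := by
    ext α β
    simp only [Matrix.conjTranspose_apply, locMatrix, Matrix.of_apply, star_trivial]
    rw [add_comm]
  simp only [hsymm, true_and]
  refine forall_congr' fun v => ?_
  rw [mul_polyOfVec_sq]
  simp only [riesz_sum, riesz_smul, dotProduct, Matrix.mulVec, star_trivial, locMatrix,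
    Matrix.of_apply, Finset.mul_sum]
  refine iff_of_eq (congrArg _ ?_)
  exact Finset.sum_congr rfl fun α _ => Finset.sum_congr rfl fun β _ => by ring

theorem exists_polyOfVec_eq {s : Finset (Fin N →₀ ℕ)} {p : MvPolynomial (Fin N) ℝ}
    (hp : p.support ⊆ s) : ∃ v : s → ℝ, polyOfVec v = p := by
  refine ⟨fun α => p.coeff α, ?_⟩
  conv_rhs => rw [← p.support_sum_monomial_coeff]
  rw [polyOfVec, Finset.sum_coe_sort s fun α => monomial α (p.coeff α)]
  refine (Finset.sum_subset hp fun α _ hα => ?_).symm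
  rw [notMem_support_iff.1 hα, monomial_zero]

open Filter in
theorem eventually_riesz_mul_isSumSq_nonneg (q : MvPolynomial (Fin N) ℝ)
    {s : MvPolynomial (Fin N) ℝ} (hs : IsSumSq s) :
    ∀ᶠ k : ℕ in atTop, ∀ w : expLE N (2 * k) → ℝ,
      (locMatrix k q w).PosSemidef → 0 ≤ riesz w (q * s) := by
  induction hs with
  | zero => exact Eventually.of_forall fun k w _ => by simp [riesz]
  | sq_add a hs ih =>
    filter_upwards [ih, eventually_ge_atTop (q.totalDegree + a.totalDegree)] with k hk hka w hw
    have hsupp : a.support ⊆ locIndex k q := fun α hα => by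
      have : α.degree ≤ a.totalDegree := by rw [Finsupp.degree_apply]; exact le_totalDegree hα
      rw [mem_locIndex]; omega
    obtain ⟨v, hv⟩ := exists_polyOfVec_eq hsupp
    rw [mul_add, riesz_add, ← hv]
    exact add_nonneg (posSemidef_locMatrix_iff.1 hw v) (hk w hw)

open Filter in
theorem eventually_riesz_mul_eq_zero (q r : MvPolynomial (Fin N) ℝ) :
    ∀ᶠ k : ℕ in atTop, ∀ w : expLE N (2 * k) → ℝ, locMatrix k q w = 0 → riesz w (q * r) = 0 := by
  filter_upwards [eventually_ge_atTop (q.totalDegree + r.totalDegree)] with k hk w hw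
  rw [← r.support_sum_monomial_coeff, Finset.mul_sum, riesz_sum]
  refine Finset.sum_eq_zero fun α hα => ?_
  have hαr : α.degree ≤ r.totalDegree := by rw [Finsupp.degree_apply]; exact le_totalDegree hα
  have h1 : α ∈ locIndex k q := mem_locIndex.2 (by omega)
  have h0 : 0 ∈ locIndex k q := mem_locIndex.2 (by rw [map_zero]; omega)
  have := congrFun (congrFun hw ⟨α, h1⟩) ⟨0, h0⟩
  simp only [locMatrix, Matrix.of_apply, add_zero, Matrix.zero_apply] at this
  rw [show monomial α (r.coeff α) = r.coeff α • monomial α (1 : ℝ) by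
    rw [smul_monomial, smul_eq_mul, mul_one], mul_smul_comm, riesz_smul, this, mul_zero]

variable {n : ℕ} {E I : Type*} {cE : E → MvPolynomial (Fin n) ℝ} {cI : I → MvPolynomial (Fin n) ℝ}

/-- The constraints on the lifted vector `w` in the `k`-th moment relaxation. -/
def Feasible (cE : E → MvPolynomial (Fin n) ℝ) (cI : I → MvPolynomial (Fin n) ℝ) (k : ℕ)
    (w : expLE (n + 1) (2 * k) → ℝ) : Prop :=
  (∀ i : Option E, locMatrix k (homEq cE i) w = 0) ∧
    (∀ j : Option I, (locMatrix k (homIneq cI j) w).PosSemidef) ∧ (locMatrix k 1 w).PosSemidef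

theorem mem_momentRelax_iff {A : Finset (Fin n →₀ ℕ)} {k : ℕ} {y : A → ℝ} :
    y ∈ momentRelax A cE cI k ↔ ∃ w, Feasible cE cI k w ∧
      ∀ α : A, ∃ h : homExp (expDeg A) α.1 ∈ expLE (n + 1) (2 * k), w ⟨_, h⟩ = y α :=
  exists_congr fun _ => and_comm

theorem isClosed_setOf_feasible (k : ℕ) : IsClosed {w | Feasible cE cI k w} := by
  have hpsd : ∀ q : MvPolynomial (Fin (n + 1)) ℝ,
      IsClosed {w : expLE (n + 1) (2 * k) → ℝ | (locMatrix k q w).PosSemidef} := by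
    intro q
    simp only [posSemidef_locMatrix_iff, Set.ofPred_forall]
    exact isClosed_iInter fun v => isClosed_le continuous_const (continuous_riesz _)
  simp only [Feasible, Set.ofPred_and, Set.ofPred_forall]
  refine (isClosed_iInter fun i => isClosed_eq ?_ continuous_const).inter
    ((isClosed_iInter fun j => hpsd _).inter (hpsd _))
  exact continuous_matrix fun α β => continuous_riesz _

open Filter in
/-- Weak duality: an element of the untruncated ideal plus quadratic module is eventually
nonnegative under all feasible Riesz functionals. -/
theorem eventually_riesz_nonneg_of_mem_idealQM [Fintype E] [Fintype I]
    {F : MvPolynomial (Fin (n + 1)) ℝ} (hF : F ∈ idealQM (homEq cE) (homIneq cI)) :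
    ∀ᶠ k : ℕ in atTop, ∀ w, Feasible cE cI k w → 0 ≤ riesz w F := by
  obtain ⟨r, s₀, s, hs₀, hs, rfl⟩ := hF
  filter_upwards [eventually_all.2 fun i => eventually_riesz_mul_eq_zero (homEq cE i) (r i),
    eventually_all.2 fun j => eventually_riesz_mul_isSumSq_nonneg (homIneq cI j) (hs j),
    eventually_riesz_mul_isSumSq_nonneg 1 hs₀] with k h1 h2 h3 w ⟨hE, hI, h0⟩
  rw [riesz_add, riesz_add, riesz_sum, riesz_sum, Finset.sum_eq_zero fun i _ => h1 i w (hE i),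
    zero_add]
  have := h3 w h0
  rw [one_mul] at this
  exact add_nonneg this (Finset.sum_nonneg fun j _ => h2 j w (hI j))

open Filter in
theorem eventually_mem_truncIdeal_add_truncQM {ι κ : Type*} [Fintype ι] [Fintype κ]
    {h : ι → MvPolynomial (Fin N) ℝ} {g : κ → MvPolynomial (Fin N) ℝ}
    {F : MvPolynomial (Fin N) ℝ} (hF : F ∈ idealQM h g) :
    ∀ᶠ k : ℕ in atTop, F ∈ truncIdeal h (2 * k) + truncQM g (2 * k) := by
  obtain ⟨r, s₀, s, hs₀, hs, rfl⟩ := hF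
  filter_upwards [eventually_all.2 fun i =>
      eventually_ge_atTop ((r i).totalDegree + (h i).totalDegree),
    eventually_all.2 fun j => eventually_ge_atTop ((s j).totalDegree + (g j).totalDegree + 1),
    eventually_ge_atTop s₀.totalDegree] with k h1 h2 h3
  exact Set.add_mem_add ⟨r, fun i _ => by have := h1 i; omega, rfl⟩
    ⟨s₀, s, ⟨hs₀, by omega⟩, fun j => ⟨hs j, fun _ => by have := h2 j; omega⟩, rfl⟩

theorem IsSumSq.eval_nonneg {s : MvPolynomial (Fin N) ℝ} (hs : IsSumSq s) (x : Fin N → ℝ) :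
    0 ≤ eval x s := by
  induction hs with
  | zero => simp
  | sq_add a hs ih => rw [map_add, map_mul]; exact add_nonneg (mul_self_nonneg _) ih

theorem eval_nonneg_of_mem_truncIdeal_add_truncQM {ι κ : Type*} [Fintype ι] [Fintype κ]
    {h : ι → MvPolynomial (Fin N) ℝ} {g : κ → MvPolynomial (Fin N) ℝ}
    {F : MvPolynomial (Fin N) ℝ} (hF : F ∈ truncIdeal h m + truncQM g m) {x : Fin N → ℝ}
    (hx : x ∈ semialgSet h g) : 0 ≤ eval x F := by
  obtain ⟨_, ⟨r, -, rfl⟩, _, ⟨s₀, s, ⟨hs₀, -⟩, hs, rfl⟩, rfl⟩ := hF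
  simp only [map_add, map_sum, map_mul, hx.1, zero_mul, Finset.sum_const_zero, zero_add]
  exact add_nonneg (hs₀.eval_nonneg x)
    (Finset.sum_nonneg fun j _ => mul_nonneg (hx.2 j) ((hs j).1.eval_nonneg x))

theorem degree_homExp {d : ℕ} {α : Fin n →₀ ℕ} (hα : α.degree ≤ d) : (homExp d α).degree = d := by
  rw [Finsupp.degree_eq_sum] at hα ⊢
  rw [Fin.sum_univ_succ]
  simp only [homExp, Finsupp.cons_zero, Finsupp.cons_succ, Finsupp.degree_eq_sum]
  omega

theorem homExp_mem_expLE {A : Finset (Fin n →₀ ℕ)} {k : ℕ} (hk : expDeg A ≤ 2 * k) (α : A) :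
    homExp (expDeg A) α.1 ∈ expLE (n + 1) (2 * k) := by
  rw [mem_expLE, degree_homExp (d := expDeg A) (Finset.le_sup (f := Finsupp.degree) α.2)]
  exact hk

/-- On homogenizations of polynomials in `ℝ[x]_A`, the Riesz functional of `w` depends only on the
vector `y` that `w` extends. -/
theorem riesz_homPoly {A : Finset (Fin n →₀ ℕ)} {p : MvPolynomial (Fin n) ℝ} (hp : p ∈ polyA A)
    {y : A → ℝ} {w : expLE (n + 1) m → ℝ} {d : ℕ}
    (hw : ∀ α : A, ∃ h : homExp d α.1 ∈ expLE (n + 1) m, w ⟨_, h⟩ = y α) :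
    riesz w (homPoly d p) = ∑ α : A, p.coeff α * y α := by
  have : homPoly d p = ∑ α ∈ A, monomial (homExp d α) (p.coeff α) :=
    Finset.sum_subset (mem_polyA_iff.1 hp) fun α _ hα => by
      rw [notMem_support_iff.1 hα, monomial_zero]
  rw [this, ← Finset.sum_coe_sort, riesz_sum]
  refine Finset.sum_congr rfl fun α _ => ?_
  obtain ⟨h, hα⟩ := hw α
  rw [riesz_monomial _ h, hα]

theorem momentRelax_succ_subset (A : Finset (Fin n →₀ ℕ)) {k : ℕ} (hk : expDeg A ≤ 2 * k) :
    momentRelax A cE cI (k + 1) ⊆ momentRelax A cE cI k := by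
  intro y hy
  obtain ⟨w, ⟨hE, hI, h1⟩, hw⟩ := mem_momentRelax_iff.1 hy
  have hle : 2 * k ≤ 2 * (k + 1) := by omega
  have hsub : ∀ q : MvPolynomial (Fin (n + 1)) ℝ, ∀ α ∈ locIndex k q, α ∈ locIndex (k + 1) q :=
    fun q α hα => mem_locIndex.2 ((mem_locIndex.1 hα).trans hle)
  have hmat : ∀ q, locMatrix k q
      (fun β => w ⟨β, mem_expLE.2 ((mem_expLE.1 β.2).trans hle)⟩) =
        (locMatrix (k + 1) q w).submatrix (fun α => ⟨α.1, hsub q α.1 α.2⟩)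
          (fun α => ⟨α.1, hsub q α.1 α.2⟩) := by
    intro q
    ext α β
    exact riesz_truncate hle w (mul_monomial_mem_polyA α β)
  refine mem_momentRelax_iff.2
    ⟨fun β => w ⟨β, mem_expLE.2 ((mem_expLE.1 β.2).trans hle)⟩, ⟨fun i => ?_, fun j => ?_, ?_⟩,
    fun α => ⟨homExp_mem_expLE hk α, ?_⟩⟩
  · rw [hmat, hE, Matrix.submatrix_zero]; rfl
  · rw [hmat]; exact (hI j).submatrix _
  · rw [hmat]; exact h1.submatrix _
  · obtain ⟨_, h⟩ := hw α
    exact h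

end Riesz

/-! ### Moment cones -/

section Moments

open MvPolynomial

variable {n : ℕ} {E I : Type*} {cE : E → MvPolynomial (Fin n) ℝ} {cI : I → MvPolynomial (Fin n) ℝ}

theorem mem_momentCone_iff {A : Finset (Fin n →₀ ℕ)} {K : Set (Fin n → ℝ)} (hK : IsClosed K)
    {y : A → ℝ} : y ∈ momentCone A K ↔ ∃ μ : Measure (Fin n → ℝ), (∀ᵐ x ∂μ, x ∈ K) ∧
      ∀ α : A, Integrable (fun x : Fin n → ℝ => ∏ i, x i ^ α.1 i) μ ∧
        y α = ∫ x : Fin n → ℝ, ∏ i, x i ^ α.1 i ∂μ := by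
  refine exists_congr fun μ => and_congr_left fun _ => ⟨fun h => ?_, fun h => ?_⟩
  · exact Filter.mem_of_superset Measure.support_mem_ae h
  · exact Measure.support_subset_of_isClosed hK h

/-- The moment cone of a closed set as a convex cone. -/
def momentPointedCone (A : Finset (Fin n →₀ ℕ)) {K : Set (Fin n → ℝ)} (hK : IsClosed K) :
    PointedCone ℝ (A → ℝ) where
  carrier := momentCone A K
  zero_mem' := ⟨0, by simp, fun α => by simp⟩
  add_mem' := by
    intro y y' hy hy'
    obtain ⟨μ, hμ, hy⟩ := (mem_momentCone_iff hK).1 hy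
    obtain ⟨ν, hν, hy'⟩ := (mem_momentCone_iff hK).1 hy'
    refine (mem_momentCone_iff hK).2 ⟨μ + ν, ae_add_measure_iff.2 ⟨hμ, hν⟩, fun α =>
      ⟨(hy α).1.add_measure (hy' α).1, ?_⟩⟩
    rw [integral_add_measure (hy α).1 (hy' α).1, Pi.add_apply, (hy α).2, (hy' α).2]
  smul_mem' := by
    rintro ⟨c, hc⟩ y hy
    obtain ⟨μ, hμ, hy⟩ := (mem_momentCone_iff hK).1 hy
    refine (mem_momentCone_iff hK).2 ⟨ENNReal.ofReal c • μ, Measure.ae_smul_measure hμ _, fun α =>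
      ⟨(hy α).1.smul_measure ENNReal.ofReal_ne_top, ?_⟩⟩
    rw [integral_smul_measure, ENNReal.toReal_ofReal hc, ← (hy α).2]
    rfl

theorem eval_eq_sum_of_mem_polyA {A : Finset (Fin n →₀ ℕ)} {p : MvPolynomial (Fin n) ℝ}
    (hp : p ∈ polyA A) (x : Fin n → ℝ) :
    eval x p = ∑ α : A, p.coeff α * ∏ i, x i ^ α.1 i := by
  rw [eval_eq', Finset.sum_coe_sort A fun α => p.coeff α * ∏ i, x i ^ α i]
  exact Finset.sum_subset (mem_polyA_iff.1 hp) fun α _ hα => by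
    rw [notMem_support_iff.1 hα, zero_mul]

/-- Farkas' lemma for the moment cone: outside the closure, there is a separating polynomial that is
nonnegative on `K`. -/
theorem exists_polynomial_of_notMem_closure_momentCone {A : Finset (Fin n →₀ ℕ)}
    {K : Set (Fin n → ℝ)} (hK : IsClosed K) {y : A → ℝ} (hy : y ∉ closure (momentCone A K)) :
    ∃ p ∈ nonnegCone A K, ∑ α : A, p.coeff α * y α < 0 := by
  let C : ProperCone ℝ (A → ℝ) :=
    ⟨(momentPointedCone A hK).closure, isClosed_closure⟩
  obtain ⟨f, hf, hfy⟩ := ProperCone.hyperplane_separation_point C (x₀ := y) hy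
  have hcoeff : ∀ α : A, (polyOfVec fun α => f (Pi.single α 1)).coeff α.1 = f (Pi.single α 1) := by
    intro α
    rw [polyOfVec, coeff_sum, Finset.sum_eq_single α]
    · rw [coeff_monomial, if_pos rfl]
    · intro β _ hβ
      rw [coeff_monomial, if_neg fun h => hβ (Subtype.ext h)]
    · simp
  have hfv : ∀ v : A → ℝ,
      f v = ∑ α : A, (polyOfVec fun α => f (Pi.single α 1)).coeff α.1 * v α := by
    intro v
    conv_lhs => rw [pi_eq_sum_univ' v]
    simp only [map_sum, map_smul, smul_eq_mul, hcoeff]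
    refine Finset.sum_congr rfl fun α _ => ?_
    rw [mul_comm]
  have hpA : (polyOfVec fun α => f (Pi.single α 1)) ∈ polyA A :=
    sum_mem fun α _ => (monomial_mem_restrictSupport ℝ).2 (Or.inl α.2)
  refine ⟨polyOfVec fun α => f (Pi.single α 1), ⟨hpA, fun x hx => ?_⟩, by rwa [← hfv]⟩
  rw [eval_eq_sum_of_mem_polyA hpA, ← hfv]
  refine hf _ (subset_closure ((mem_momentCone_iff hK).2 ⟨Measure.dirac x, ?_, fun α => ⟨?_, ?_⟩⟩))
  · exact (ae_dirac_iff (p := (· ∈ K)) hK.measurableSet).2 hx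
  · exact integrable_dirac (by simp [enorm_lt_top])
  · rw [integral_dirac]

/-! ### Measures on `K` give feasible points of the moment relaxations -/

/-- The moments of the image of the measure `‖(1, x)‖^d dμ` under the projection to the sphere. -/
def sphereMoments (d k : ℕ) (μ : Measure (Fin n → ℝ)) : expLE (n + 1) (2 * k) → ℝ :=
  fun β => ∫ x, liftNorm x ^ d * ∏ i, sphereLift x i ^ β.1 i ∂μ

variable {d k : ℕ} {μ : Measure (Fin n → ℝ)}

theorem abs_prod_sphereLift_le (β : Fin (n + 1) →₀ ℕ) (x : Fin n → ℝ) :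
    |∏ i, sphereLift x i ^ β i| ≤ 1 := by
  rw [Finset.abs_prod]
  refine Finset.prod_le_one (fun i _ => abs_nonneg _) fun i _ => ?_
  rw [abs_pow]
  exact pow_le_one₀ (abs_nonneg _) (abs_le_one_of_sum_sq_eq_one (sum_sq_sphereLift x) i)

theorem norm_liftNorm_pow_mul_prod_le (β : Fin (n + 1) →₀ ℕ) (x : Fin n → ℝ) :
    ‖liftNorm x ^ d * ∏ i, sphereLift x i ^ β i‖ ≤ liftNorm x ^ d := by
  have h0 : 0 ≤ liftNorm x ^ d := (pow_pos (liftNorm_pos x) d).le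
  rw [norm_mul, Real.norm_eq_abs, Real.norm_eq_abs, abs_of_nonneg h0]
  exact mul_le_of_le_one_right h0 (abs_prod_sphereLift_le β x)

theorem integrable_liftNorm_pow_mul_prod (hμ : Integrable (fun x => liftNorm x ^ d) μ)
    (β : Fin (n + 1) →₀ ℕ) :
    Integrable (fun x => liftNorm x ^ d * ∏ i, sphereLift x i ^ β i) μ := by
  refine hμ.mono' ?_ (Filter.Eventually.of_forall (norm_liftNorm_pow_mul_prod_le β))
  have : Continuous fun x : Fin n → ℝ => liftNorm x ^ d * ∏ i, sphereLift x i ^ β i := by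
    refine (continuous_liftNorm.pow d).mul (continuous_finsetProd _ fun i _ => ?_)
    exact ((continuous_apply i).comp continuous_sphereLift).pow _
  exact this.aestronglyMeasurable

theorem abs_sphereMoments_le (hμ : Integrable (fun x => liftNorm x ^ d) μ)
    (β : expLE (n + 1) (2 * k)) : |sphereMoments d k μ β| ≤ ∫ x, liftNorm x ^ d ∂μ :=
  norm_integral_le_of_norm_le hμ (Filter.Eventually.of_forall (norm_liftNorm_pow_mul_prod_le β.1))

theorem riesz_sphereMoments (hμ : Integrable (fun x => liftNorm x ^ d) μ)
    {p : MvPolynomial (Fin (n + 1)) ℝ} (hp : p ∈ polyA (expLE (n + 1) (2 * k))) :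
    riesz (sphereMoments d k μ) p = ∫ x, liftNorm x ^ d * eval (sphereLift x) p ∂μ := by
  simp only [eval_eq_sum_of_mem_polyA hp, Finset.mul_sum, mul_left_comm _ (coeff _ p)]
  rw [integral_finsetSum _ fun β _ => (integrable_liftNorm_pow_mul_prod hμ β.1).const_mul _]
  simp only [integral_const_mul]
  rfl

theorem feasible_sphereMoments (hμ : Integrable (fun x => liftNorm x ^ d) μ)
    (hμK : ∀ᵐ x ∂μ, x ∈ semialgSet cE cI) : Feasible cE cI k (sphereMoments d k μ) := by
  have hpsd : ∀ q : MvPolynomial (Fin (n + 1)) ℝ,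
      (∀ z ∈ semialgSet (homEq cE) (homIneq cI), 0 ≤ eval z q) →
        (locMatrix k q (sphereMoments d k μ)).PosSemidef := by
    intro q hq
    refine posSemidef_locMatrix_iff.2 fun v => ?_
    rw [riesz_sphereMoments hμ (mul_polyOfVec_sq_mem_polyA v)]
    refine integral_nonneg_of_ae (hμK.mono fun x hx => ?_)
    simp only [Pi.zero_apply, map_mul]
    exact mul_nonneg (pow_pos (liftNorm_pos x) d).le
      (mul_nonneg (hq _ (sphereLift_mem hx)) (mul_self_nonneg _))
  refine ⟨fun i => ?_, fun j => hpsd _ fun z hz => hz.2 j, hpsd 1 fun z _ => by simp⟩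
  ext α β
  rw [locMatrix, Matrix.of_apply, riesz_sphereMoments hμ (mul_monomial_mem_polyA α β)]
  refine integral_eq_zero_of_ae (hμK.mono fun x hx => ?_)
  simp [(sphereLift_mem hx).1 i]

theorem sphereMoments_homExp {α : Fin n →₀ ℕ} (hα : α.degree ≤ d)
    (h : homExp d α ∈ expLE (n + 1) (2 * k)) :
    sphereMoments d k μ ⟨_, h⟩ = ∫ x, ∏ i, x i ^ α i ∂μ := by
  refine integral_congr_ae (Filter.Eventually.of_forall fun x => ?_)
  have hdeg : (monomial α (1 : ℝ)).totalDegree ≤ d := by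
    rw [totalDegree_monomial _ one_ne_zero]; exact hα
  have := eval_sphereLift_homPoly hdeg x
  rw [homPoly, support_monomial, if_neg one_ne_zero, Finset.sum_singleton, coeff_monomial,
    if_pos rfl, eval_monomial, eval_monomial, one_mul, one_mul, Finsupp.prod_fintype _ _ (by simp),
    Finsupp.prod_fintype _ _ (by simp)] at this
  exact this

/-- If `q ∈ ℝ[x]_A` is interior to `P_d(K)`, then it dominates `‖(1, x)‖^d` on `K`, so every
measure on `K` with finite `A`-moments has finite moments up to order `d`, bounded in terms of the
value at `q`. -/
theorem integrable_liftNorm_pow {A : Finset (Fin n →₀ ℕ)} {q : MvPolynomial (Fin n) ℝ}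
    (hqA : q ∈ polyA A) {ε : ℝ} (hε : 0 < ε)
    (hq : ∀ z ∈ semialgSet (homEq cE) (homIneq cI), ε ≤ eval z (homPoly (expDeg A) q))
    (hμK : ∀ᵐ x ∂μ, x ∈ semialgSet cE cI) {y : A → ℝ}
    (hy : ∀ α : A, Integrable (fun x : Fin n → ℝ => ∏ i, x i ^ α.1 i) μ ∧
      y α = ∫ x : Fin n → ℝ, ∏ i, x i ^ α.1 i ∂μ) :
    Integrable (fun x => liftNorm x ^ expDeg A) μ ∧
      ∫ x, liftNorm x ^ expDeg A ∂μ ≤ ε⁻¹ * ∑ α : A, q.coeff α * y α := by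
  have hint : Integrable (fun x => ε⁻¹ * eval x q) μ := by
    simp only [eval_eq_sum_of_mem_polyA hqA]
    exact (integrable_finsetSum _ fun α _ => (hy α).1.const_mul _).const_mul _
  have hle : ∀ᵐ x ∂μ, liftNorm x ^ expDeg A ≤ ε⁻¹ * eval x q := by
    filter_upwards [hμK] with x hx
    rw [← eval_sphereLift_homPoly (totalDegree_le_expDeg hqA) x, inv_mul_eq_div, le_div_iff₀ hε]
    exact mul_le_mul_of_nonneg_left (hq _ (sphereLift_mem hx)) (pow_pos (liftNorm_pos x) _).le
  have hN : Integrable (fun x => liftNorm x ^ expDeg A) μ := by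
    refine hint.mono' (continuous_liftNorm.pow _).aestronglyMeasurable (hle.mono fun x hx => ?_)
    rwa [Real.norm_eq_abs, abs_of_nonneg (pow_pos (liftNorm_pos x) _).le]
  refine ⟨hN, (integral_mono_ae hN hint hle).trans_eq ?_⟩
  rw [integral_const_mul]
  simp only [eval_eq_sum_of_mem_polyA hqA]
  rw [integral_finsetSum _ fun α _ => (hy α).1.const_mul _]
  simp only [integral_const_mul, (hy _).2]

/-! ### Convergence of the moment and sum-of-squares hierarchies -/

/-- The value of `y` at an interior point `q` of `P_d(K)` bounds the lifted vector, so near a given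
`y` the moment cone lies in the image of a compact set of feasible points. -/
theorem closure_momentCone_subset_momentRelax {A : Finset (Fin n →₀ ℕ)}
    {q : MvPolynomial (Fin n) ℝ} (hqA : q ∈ polyA A) {ε : ℝ} (hε : 0 < ε)
    (hq : ∀ z ∈ semialgSet (homEq cE) (homIneq cI), ε ≤ eval z (homPoly (expDeg A) q))
    (hk : expDeg A ≤ 2 * k) :
    closure (momentCone A (semialgSet cE cI)) ⊆ momentRelax A cE cI k := by
  intro y hy
  set c : ℝ := ∑ α : A, q.coeff α * y α + 1 with hc
  let Γ : Set (expLE (n + 1) (2 * k) → ℝ) :=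
    {w | Feasible cE cI k w} ∩ Set.univ.pi fun _ => Set.Icc (-(ε⁻¹ * c)) (ε⁻¹ * c)
  let π : (expLE (n + 1) (2 * k) → ℝ) → A → ℝ := fun w α => w ⟨_, homExp_mem_expLE hk α⟩
  have hΓ : IsCompact Γ :=
    (isCompact_univ_pi fun _ => isCompact_Icc).inter_left (isClosed_setOf_feasible k)
  have himage : IsClosed (π '' Γ) := (hΓ.image (by fun_prop)).isClosed
  have hopen : IsOpen {y' : A → ℝ | ∑ α : A, q.coeff α * y' α < c} :=
    isOpen_lt (by fun_prop) continuous_const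
  have hsub : {y' : A → ℝ | ∑ α : A, q.coeff α * y' α < c} ∩
      momentCone A (semialgSet cE cI) ⊆ π '' Γ := by
    rintro y' ⟨hy'c, hy'⟩
    obtain ⟨μ, hμK, hμ⟩ := (mem_momentCone_iff (isClosed_semialgSet _ _)).1 hy'
    obtain ⟨hN, hNle⟩ := integrable_liftNorm_pow hqA hε hq hμK hμ
    refine ⟨sphereMoments (expDeg A) k μ, ⟨feasible_sphereMoments hN hμK, fun β _ => ?_⟩, ?_⟩
    · refine abs_le.1 ((abs_sphereMoments_le hN β).trans (hNle.trans ?_))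
      exact mul_le_mul_of_nonneg_left (le_of_lt hy'c) (inv_pos.2 hε).le
    · funext α
      rw [(hμ α).2]
      exact sphereMoments_homExp (Finset.le_sup (f := Finsupp.degree) α.2) _
  obtain ⟨w, hw, hwy⟩ := closure_minimal hsub himage
    (hopen.inter_closure ⟨by simp [hc], hy⟩)
  exact mem_momentRelax_iff.2 ⟨w, hw.1, fun α => ⟨homExp_mem_expLE hk α, congrFun hwy α⟩⟩

variable [Fintype E] [Fintype I]

theorem mem_closure_momentCone_of_forall_mem_momentRelax (hclosed : ClosedAtInfinity cE cI)
    {A : Finset (Fin n →₀ ℕ)} {q : MvPolynomial (Fin n) ℝ} (hqA : q ∈ polyA A)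
    (hq : ∀ z ∈ semialgSet (homEq cE) (homIneq cI), 0 < eval z (homPoly (expDeg A) q))
    {y : A → ℝ} (hy : ∀ k : ℕ, 1 ≤ k → expDeg A ≤ 2 * k → y ∈ momentRelax A cE cI k) :
    y ∈ closure (momentCone A (semialgSet cE cI)) := by
  by_contra hyn
  obtain ⟨p, ⟨hpA, hp⟩, hpy⟩ :=
    exists_polynomial_of_notMem_closure_momentCone (isClosed_semialgSet _ _) hyn
  -- Adding a small multiple of `q` makes the homogenization of `p` positive on the sphere, while
  -- keeping its value at `y` negative.
  set a := ∑ α : A, p.coeff α * y α with ha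
  set b := ∑ α : A, q.coeff α * y α with hb
  obtain ⟨ε, hε, hεb⟩ : ∃ ε > 0, a + ε * b < 0 := by
    refine ⟨-a / (2 * (|b| + 1)), by have := abs_nonneg b; apply div_pos <;> linarith, ?_⟩
    have h1 : 0 < |b| + 1 := by positivity
    have h2 : -a / (2 * (|b| + 1)) * b ≤ -a / (2 * (|b| + 1)) * (|b| + 1) :=
      mul_le_mul_of_nonneg_left (by linarith [le_abs_self b])
        (div_nonneg (by linarith) (by linarith))
    have h3 : -a / (2 * (|b| + 1)) * (|b| + 1) = -a / 2 := by field_simp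
    linarith
  have hrA : p + ε • q ∈ polyA A := add_mem hpA (Submodule.smul_mem _ _ hqA)
  have hpos : ∀ z ∈ semialgSet (homEq cE) (homIneq cI),
      0 < eval z (homPoly (expDeg A) (p + ε • q)) := by
    intro z hz
    refine (mul_pos hε (hq z hz)).trans_le (mul_eval_homPoly_le hclosed
      (totalDegree_le_expDeg hqA) (totalDegree_le_expDeg hrA) (fun x hx => ?_)
      (mem_semialgSet_homEq_homIneq.1 hz).1)
    rw [map_add, smul_eval]
    linarith [hp x hx]
  obtain ⟨k, hk, hk1, hkd⟩ := ((eventually_riesz_nonneg_of_mem_idealQM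
    (mem_idealQM_of_pos (i₀ := none) rfl hpos)).and
      ((Filter.eventually_ge_atTop 1).and (Filter.eventually_ge_atTop (expDeg A)))).exists
  obtain ⟨w, hw, hwy⟩ := mem_momentRelax_iff.1 (hy k hk1 (by omega))
  have h0 := hk w hw
  rw [riesz_homPoly hrA hwy] at h0
  simp only [coeff_add, coeff_smul, smul_eq_mul, add_mul, mul_assoc, Finset.sum_add_distrib,
    ← Finset.mul_sum] at h0
  linarith

theorem exists_mem_sosApprox_of_mem_interiorA (hclosed : ClosedAtInfinity cE cI)
    {A : Finset (Fin n →₀ ℕ)} {p q : MvPolynomial (Fin n) ℝ} (hqA : q ∈ polyA A)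
    (hq : ∀ z ∈ semialgSet (homEq cE) (homIneq cI), 0 < eval z (homPoly (expDeg A) q))
    (hp : p ∈ interiorA A (nonnegCone A (semialgSet cE cI))) :
    ∃ k, 1 ≤ k ∧ p ∈ sosApprox A cE cI k := by
  obtain ⟨ε, hε, hle⟩ := exists_pos_mul_eval_le hp hqA
  have hpos : ∀ z ∈ semialgSet (homEq cE) (homIneq cI), 0 < eval z (homogenization p) := by
    intro z hz
    have hzK := (mem_semialgSet_homEq_homIneq.1 hz).1
    have h1 := (mul_pos hε (hq z hz)).trans_le (mul_eval_homPoly_le hclosed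
      (totalDegree_le_expDeg hqA) (totalDegree_le_expDeg hp.1) hle hzK)
    -- If `deg p < d`, the two homogenizations differ by a power of `x₀ ≥ 0`.
    rw [eval_homPoly_eq_pow_mul le_rfl (totalDegree_le_expDeg hp.1)] at h1
    exact pos_of_mul_pos_right h1 (pow_nonneg hzK.2 _)
  obtain ⟨k, hk, hk1⟩ := ((eventually_mem_truncIdeal_add_truncQM
    (mem_idealQM_of_pos (i₀ := none) rfl hpos)).and (Filter.eventually_ge_atTop 1)).exists
  exact ⟨k, hk1, hp.1, hk⟩

theorem sosApprox_subset_nonnegCone (A : Finset (Fin n →₀ ℕ)) :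
    sosApprox A cE cI k ⊆ nonnegCone A (semialgSet cE cI) := by
  rintro p ⟨hpA, hp⟩
  refine ⟨hpA, fun x hx => ?_⟩
  rw [← eval_sphereLift_homPoly le_rfl x]
  exact mul_nonneg (pow_pos (liftNorm_pos x) _).le
    (eval_nonneg_of_mem_truncIdeal_add_truncQM hp (sphereLift_mem hx))

end Moments

end

theorem theorem3p10 {n : ℕ} {E I : Type*} [Fintype E] [Fintype I]
    (cE : E → MvPolynomial (Fin n) ℝ) (cI : I → MvPolynomial (Fin n) ℝ)
    (A : Finset (Fin n →₀ ℕ))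
    (hclosed : ClosedAtInfinity cE cI)
    (hint : ((polyA A : Set (MvPolynomial (Fin n) ℝ)) ∩
      interiorA (expLE n (expDeg A))
        (nonnegCone (expLE n (expDeg A)) (semialgSet cE cI))).Nonempty) :
    (∀ k : ℕ, expDeg A ≤ 2 * k → momentRelax A cE cI (k + 1) ⊆ momentRelax A cE cI k) ∧
    (⋂ k ∈ {k : ℕ | 1 ≤ k ∧ expDeg A ≤ 2 * k}, momentRelax A cE cI k) =
      closure (momentCone A (semialgSet cE cI)) ∧
    interiorA A (nonnegCone A (semialgSet cE cI)) ⊆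
      (⋃ k ∈ {k : ℕ | 1 ≤ k}, sosApprox A cE cI k) ∧
    (⋃ k ∈ {k : ℕ | 1 ≤ k}, sosApprox A cE cI k) ⊆ nonnegCone A (semialgSet cE cI) := by
  obtain ⟨q, hqA, hqint⟩ := hint
  have hq : ∀ z ∈ semialgSet (homEq cE) (homIneq cI),
      0 < MvPolynomial.eval z (homPoly (expDeg A) q) := fun z hz =>
    eval_homPoly_pos_of_mem_interiorA hclosed hqint (totalDegree_le_expDeg hqA) hz
  obtain ⟨ε, hε, hqε⟩ := exists_pos_le_of_isCompact isCompact_semialgSet_homEq_homIneq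
    (MvPolynomial.continuous_eval _).continuousOn hq
  refine ⟨fun k hk => momentRelax_succ_subset A hk, Set.Subset.antisymm (fun y hy => ?_) ?_,
    fun p hp => ?_, Set.iUnion₂_subset fun k _ => sosApprox_subset_nonnegCone A⟩
  · rw [Set.mem_iInter₂] at hy
    exact mem_closure_momentCone_of_forall_mem_momentRelax hclosed hqA hq
      fun k h1 hk => hy k ⟨h1, hk⟩
  · exact Set.subset_iInter₂ fun k hk => closure_momentCone_subset_momentRelax hqA hε hqε hk.2
  · obtain ⟨k, hk, hpk⟩ := exists_mem_sosApprox_of_mem_interiorA hclosed hqA hq hp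
    exact Set.mem_iUnion₂.2 ⟨k, hk, hpk⟩
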